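/- **Setting (noisy stochastic block model).** Let $Q\ge 1$, $n\ge 2$, $\mathcal A=\{(i,j):1\le i<j\le n\}$, $m=n(n-1)/2$. Let $\{g_{0,t}\}_{t\in\mathcal T_0}$ and $\{g_t\}_{t\in\mathcal T}$ be families of probability densities on $\mathbb R$, with $\mathcal T_0\subset\mathbb R^{d_0}$, $\mathcal T\subset\mathbb R^{d_1}$ open and non-empty. A parameter is $\theta=(\pi,w,\nu_0,\nu)$ with $\pi_q>0$, $\sum_q\pi_q=1$, $w_{q,\ell}\in(0,1)$ and $\nu_{q,\ell}\in\mathcal T$ symmetric in $(q,\ell)$, $\nu_0\in\mathcal T_0$. Under $\mathbb P_\theta$: $Z_1,\dots,Z_n$ are i.i.d. on $\{1,\dots,Q\}$ with law $\pi$; given $Z$, the $A_{i,j}$, $(i,j)\in\mathcal A$, are independent Bernoulli$(w_{Z_i,Z_j})$; given $(Z,A)$, the $X_{i,j}$ are independent with density $g_{0,\nu_0}$ if $A_{i,j}=0$ and $g_{\nu_{Z_i,Z_j}}$ if $A_{i,j}=1$. Only $X$ is observed. The parameter space $\Theta$ is a set of such parameters that is stable under $\theta\mapsto\theta^\sigma=((\pi_{\sigma(q)}),(w_{\sigma(q),\sigma(\ell)}),\nu_0,(\nu_{\sigma(q),\sigma(\ell)}))$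 for every permutation $\sigma$ of $\{1,\dots,Q\}$. Put $\boldsymbol\pi_0=\sum_{q,\ell}\pi_q\pi_\ell(1-w_{q,\ell})$, $\boldsymbol\pi_1=\sum_{q,\ell}\pi_q\pi_\ell w_{q,\ell}$, and (with $0/0=0$) $$\boldsymbol\ell(x,q,\ell,\theta)=\frac{(1-w_{q,\ell})g_{0,\nu_0}(x)}{(1-w_{q,\ell})g_{0,\nu_0}(x)+w_{q,\ell}g_{\nu_{q,\ell}}(x)},\qquad \boldsymbol q_\delta(t,q,\ell;\theta',\theta)=\mathbb P_{\theta'}\big(\boldsymbol\ell(X_{i,j},q,\ell,\theta)\le t\mid Z_i=q,Z_j=\ell,A_{i,j}=\delta\big),$$ $$\mathbf Q_{\theta'}(\theta,t)=\frac{\sum_{q,\ell}\pi'_q\pi'_\ell(1-w'_{q,\ell})\boldsymbol q_0(t,q,\ell;\theta',\theta)}{\sum_{q,\ell}\pi'_q\pi'_\ell[(1-w'_{q,\ell})\boldsymbol q_0(t,q,\ell;\theta',\theta)+w'_{q,\ell}\boldsymbol q_1(t,q,\ell;\theta',\theta)]},\qquad T_\theta(y)=\max\{t\in[0,1]:\mathbf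 Q_\theta(\theta,t)\le y\}.$$ The $q$-values are $q_{i,j}(X,z;\theta)=\mathbf Q_\theta(\theta,\boldsymbol\ell(X_{i,j},z_i,z_j,\theta))$. For a level $\alpha$, the oracle procedure is $\varphi^*_{i,j}=\mathbf 1\{q_{i,j}(X,Z;\theta_0)\le\alpha\}$. For measurable estimators $\hat\theta=\hat\theta(X)\in\Theta$ and $\hat Z=\hat Z(X)\in\{1,\dots,Q\}^n$, the plug-in procedure is $\hat\varphi_{i,j}=\mathbf 1\{q_{i,j}(X,\hat Z;\hat\theta)\le\alpha\}$ (assumed measurable); $\varphi^{\mathrm{VEM}}$ is $\hat\varphi$ for the output $(\hat\theta,\hat Z)$ of the variational EM algorithm. Let $\mathrm{TDR}(\theta,\varphi)=\mathbb E_\theta[\sum_{\mathcal A}A_{i,j}\varphi_{i,j}]/\mathbb E_\theta[\sum_{\mathcal A}A_{i,j}]$, and $\|(\theta',z')-(\theta,z)\|=\min_\sigma\{\|\theta'^\sigma-\theta\|_\infty\vee\|z'-(\sigma(z_i))_i\|_\infty\}$. **Assumptions.** (Regularity) For all $q,\ell$ and $\delta\in\{0,1\}$: $(t,\theta,\theta_0)\mapsto\boldsymbol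 q_\delta(t,q,\ell;\theta_0,\theta)$ is continuous on $[0,1]\times\Theta^2$; and there are functions $0\le t_{1,q,\ell}(\theta)<t_{2,q,\ell}(\theta)\le1$ on $\Theta$ such that for all $\theta,\theta_0\in\Theta$ the map $t\mapsto\boldsymbol q_\delta(t,q,\ell;\theta_0,\theta)$ is $0$ on $[0,t_{1,q,\ell}(\theta)]$, strictly increasing on $[t_{1,q,\ell}(\theta),t_{2,q,\ell}(\theta)]$ and $1$ on $[t_{2,q,\ell}(\theta),1]$. (Complexity, for an integer $K\ge1$) For all $\theta\in\Theta$, $q,\ell$, $t\in[0,1]$, the set $\{x:\boldsymbol\ell(x,q,\ell,\theta)\le t\}$ is a union of $K$ pairwise disjoint (possibly empty) intervals of $\mathbb R$, with or without their end points. Fix $\theta_0=(\pi,w,\nu_0,\nu)\in\Theta$, let $\alpha_*=\lim_{t\downarrow t_1(\theta_0)}\mathbf Q_{\theta_0}(\theta_0,t)$ with $t_1(\theta_0)=\min_{q,\ell}t_{1,q,\ell}(\theta_0)$, let $\mathcal K\subset(\alpha_*,\boldsymbol\pi_0)$ be a compact interval with $\alpha$ in its interior, $\pi_{\min}=\min_q\pi_q$,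 $w_{\min}=\min_{q,\ell}w_{q,\ell}$, and $$\kappa=\sum_{q,\ell}\pi_q\pi_\ell[(1-w_{q,\ell})\boldsymbol q_0(t_{\mathcal K},q,\ell;\theta_0,\theta_0)+w_{q,\ell}\boldsymbol q_1(t_{\mathcal K},q,\ell;\theta_0,\theta_0)],\quad t_{\mathcal K}=T_{\theta_0}(\min\mathcal K),$$ $$\mathcal W_{\alpha,T}(u)=\sup\{|T_{\theta_0}(y)-T_{\theta_0}(\alpha)|:y\in\mathcal K,|y-\alpha|\le u\},$$ $$\mathcal W_{T,\boldsymbol q_1}(u)=\sup_{q,\ell}\sup\{|\boldsymbol q_1(t,q,\ell;\theta_0,\theta_0)-\boldsymbol q_1(T_{\theta_0}(\alpha),q,\ell;\theta_0,\theta_0)|:t\in T_{\theta_0}(\mathcal K),|t-T_{\theta_0}(\alpha)|\le u\},$$ $$\mathcal W_{\theta_0,\boldsymbol q}(u)=\sup_{q,\ell}\sup_{t\in T_{\theta_0}(\mathcal K)}\sup_{\delta}\sup\{|\boldsymbol q_\delta(t,q,\ell;\theta',\theta)-\boldsymbol q_\delta(t,q,\ell;\theta_0,\theta_0)|:\theta,\theta'\in\Theta,\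 \|\theta-\theta_0\|_\infty\vee\|\theta'-\theta_0\|_\infty\le u\}.$$ **Theorem 2.** Under the regularity assumption there exists $e\in(0,1)$, depending only on the model ($Q$, the density families, $\Theta$), $\theta_0$, $\alpha$ and $\mathcal K$ (not on $n$, $K$ or the estimators), such that for every $K\ge1$ for which the complexity assumption holds, every $n\ge2$, all measurable estimators $(\hat\theta,\hat Z)$ as above (in particular those of the variational EM algorithm, for which $\hat\varphi=\varphi^{\mathrm{VEM}}$), all $\varepsilon\in(0,e)$ and all $0<x<\pi_{\min}^2\wedge w_{\min}$, $$\begin{aligned}\boldsymbol\pi_1\mathrm{TDR}(\theta_0,\hat\varphi)\ge{}&\boldsymbol\pi_1\mathrm{TDR}(\theta_0,\varphi^*)-x-\boldsymbol\pi_1\mathbb P_{\theta_0}\big(\|(\hat\theta,\hat Z)-(\theta_0,Z)\|>\varepsilon\big)-2\mathcal W_{\theta_0,\boldsymbol q}(\varepsilon)-6Q^2\varepsilon\\&-\mathcal W_{T,\boldsymbol q_1}\circ\mathcal W_{\alpha,T}\big(8\kappa^{-1}(\mathcal W_{\theta_0,\boldsymbol q}(\varepsilon)+3Q^2\varepsilon)\big)-2Q^2e^{-2\lfloor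 n/2\rfloor x^2/(9Q^4)}-6KQ^2e^{-m\pi_{\min}^2w_{\min}x^2/(9K^2)}.\end{aligned}$$ -/

import Mathlib

open MeasureTheory Set Filter Topology

noncomputable section

namespace NSBM

/-- A parametric family of probability densities on `ℝ` (with respect to Lebesgue measure),
indexed by a non-empty open subset `carrier` of `ℝ^d`. -/
structure DensityFamily (d : ℕ) where
  carrier : Set (Fin d → ℝ)
  isOpen_carrier : IsOpen carrier
  nonempty_carrier : carrier.Nonempty
  dens : (Fin d → ℝ) → ℝ → ℝ
  measurable_dens : ∀ ν ∈ carrier, Measurable (dens ν)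
  dens_nonneg : ∀ ν ∈ carrier, ∀ x, 0 ≤ dens ν x
  lintegral_dens : ∀ ν ∈ carrier, ∫⁻ x, ENNReal.ofReal (dens ν x) = 1

/-- The global parameter `θ = (π, w, ν₀, ν)` with `Q` groups. The norm of this product type is
the sup norm of all the coordinates. -/
abbrev Param (Q d₀ d₁ : ℕ) : Type :=
  (Fin Q → ℝ) × (Fin Q → Fin Q → ℝ) × (Fin d₀ → ℝ) × (Fin Q → Fin Q → Fin d₁ → ℝ)

/-- The edges `(i, j)`, `i < j`. -/
abbrev Edge (n : ℕ) : Type := {p : Fin n × Fin n // p.1 < p.2}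

/-- The possible values of the observation `X`. -/
abbrev Obs (n : ℕ) : Type := Edge n → ℝ

/-- The possible values of `(Z, A, X)`: group memberships, latent graph, observation. -/
abbrev Sample (n Q : ℕ) : Type := (Fin n → Fin Q) × (Edge n → Bool) × Obs n

variable {Q d₀ d₁ : ℕ}

namespace Param

/-- Group proportions `π`. -/
def grp (θ : Param Q d₀ d₁) : Fin Q → ℝ := θ.1

/-- Connection probabilities `w`. -/
def con (θ : Param Q d₀ d₁) : Fin Q → Fin Q → ℝ := θ.2.1

/-- Null parameter `ν₀`. -/
def nul (θ : Param Q d₀ d₁) : Fin d₀ → ℝ := θ.2.2.1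

/-- Effect parameters `ν`. -/
def eff (θ : Param Q d₀ d₁) : Fin Q → Fin Q → Fin d₁ → ℝ := θ.2.2.2

/-- The relabelled parameter `θ^σ`. -/
def relabel (σ : Equiv.Perm (Fin Q)) (θ : Param Q d₀ d₁) : Param Q d₀ d₁ :=
  (fun q => θ.grp (σ q), fun q l => θ.con (σ q) (σ l), θ.nul, fun q l => θ.eff (σ q) (σ l))

/-- `𝝅₀ = ∑ π_q π_l (1 - w_{q,l})`. -/
def pi0 (θ : Param Q d₀ d₁) : ℝ := ∑ q, ∑ l, θ.grp q * θ.grp l * (1 - θ.con q l)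

/-- `𝝅₁ = ∑ π_q π_l w_{q,l}`. -/
def pi1 (θ : Param Q d₀ d₁) : ℝ := ∑ q, ∑ l, θ.grp q * θ.grp l * θ.con q l

/-- `π_min`, the minimum of the `π_q`. -/
def piMin (θ : Param Q d₀ d₁) : ℝ := ⨅ q, θ.grp q

/-- `w_min`, the minimum of the `w_{q,l}`. -/
def wMin (θ : Param Q d₀ d₁) : ℝ := ⨅ p : Fin Q × Fin Q, θ.con p.1 p.2

end Param

variable (G₀ : DensityFamily d₀) (G₁ : DensityFamily d₁)

/-- The parameters of the noisy stochastic block model (with `π_q > 0`, `0 < w_{q,l} < 1`). -/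
def admissible : Set (Param Q d₀ d₁) :=
  {θ | (∀ q, 0 < θ.grp q) ∧ ∑ q, θ.grp q = 1 ∧
    (∀ q l, 0 < θ.con q l ∧ θ.con q l < 1) ∧ (∀ q l, θ.con q l = θ.con l q) ∧
    θ.nul ∈ G₀.carrier ∧ (∀ q l, θ.eff q l ∈ G₁.carrier) ∧ (∀ q l, θ.eff q l = θ.eff l q)}

/-- A parameter space `Θ`: admissible parameters, stable under relabelling of the groups. -/
structure IsParamSpace (Θ : Set (Param Q d₀ d₁)) : Prop where
  subset_admissible : Θ ⊆ admissible G₀ G₁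
  relabel_mem : ∀ θ ∈ Θ, ∀ σ : Equiv.Perm (Fin Q), θ.relabel σ ∈ Θ

/-- The density of `X_{i,j}` given `Z_i = q`, `Z_j = l` and `A_{i,j} = δ`. -/
def noiseDens (θ : Param Q d₀ d₁) (δ : Bool) (q l : Fin Q) : ℝ → ℝ :=
  if δ then G₁.dens (θ.eff q l) else G₀.dens θ.nul

/-- The law of `X_{i,j}` given `Z_i = q`, `Z_j = l` and `A_{i,j} = δ`. -/
def noiseLaw (θ : Param Q d₀ d₁) (δ : Bool) (q l : Fin Q) : Measure ℝ :=
  volume.withDensity fun x => ENNReal.ofReal (noiseDens G₀ G₁ θ δ q l x)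

/-- The probability that `Z = z` and `A = a`: the `Z_i` are i.i.d. with law `π` and, given `Z`,
the `A_{i,j}`, `i < j`, are independent Bernoulli variables with parameters `w_{Z_i,Z_j}`. -/
def latentProb {n : ℕ} (θ : Param Q d₀ d₁) (z : Fin n → Fin Q) (a : Edge n → Bool) : ℝ :=
  (∏ i, θ.grp (z i)) *
    ∏ e : Edge n, if a e then θ.con (z e.1.1) (z e.1.2) else 1 - θ.con (z e.1.1) (z e.1.2)

/-- The law `P_θ` of `(Z, A, X)`: given `(Z, A)`, the `X_{i,j}` are independent with the laws
`noiseLaw`. -/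
def law (n : ℕ) (θ : Param Q d₀ d₁) : Measure (Sample n Q) :=
  ∑ z : Fin n → Fin Q, ∑ a : Edge n → Bool,
    ENNReal.ofReal (latentProb θ z a) •
      (Measure.pi fun e : Edge n => noiseLaw G₀ G₁ θ (a e) (z e.1.1) (z e.1.2)).map
        fun x => (z, a, x)

/-- The `ℓ`-value functional
`(1 - w_{q,l}) g_{0,ν₀}(x) / ((1 - w_{q,l}) g_{0,ν₀}(x) + w_{q,l} g_{ν_{q,l}}(x))`
(with the convention `0 / 0 = 0`). -/
def lfun (x : ℝ) (q l : Fin Q) (θ : Param Q d₀ d₁) : ℝ :=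
  (1 - θ.con q l) * G₀.dens θ.nul x /
    ((1 - θ.con q l) * G₀.dens θ.nul x + θ.con q l * G₁.dens (θ.eff q l) x)

/-- The `ℓ`-value of the edge `e`, for the clustering `z` and the parameter `θ`. -/
def lvalue {n : ℕ} (x : Obs n) (z : Fin n → Fin Q) (θ : Param Q d₀ d₁) (e : Edge n) : ℝ :=
  lfun G₀ G₁ (x e) (z e.1.1) (z e.1.2) θ

/-- `𝒒_δ(t, q, l; θ', θ) = P_{θ'}(ℓ(X_{i,j}, q, l; θ) ≤ t | Z_i = q, Z_j = l, A_{i,j} = δ)`. -/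
def qfun (δ : Bool) (t : ℝ) (q l : Fin Q) (θ' θ : Param Q d₀ d₁) : ℝ :=
  (noiseLaw G₀ G₁ θ' δ q l).real {x | lfun G₀ G₁ x q l θ ≤ t}

/-- The marginal false discovery rate `Q_{θ'}(θ, t)`, under `P_{θ'}`, of the rejection of the
edges with `ℓ_{i,j}(X, Z; θ) ≤ t` (with the convention `0 / 0 = 0`). -/
def mfdr (θ' θ : Param Q d₀ d₁) (t : ℝ) : ℝ :=
  (∑ q, ∑ l, θ'.grp q * θ'.grp l * ((1 - θ'.con q l) * qfun G₀ G₁ false t q l θ' θ)) /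
    ∑ q, ∑ l, θ'.grp q * θ'.grp l *
      ((1 - θ'.con q l) * qfun G₀ G₁ false t q l θ' θ + θ'.con q l * qfun G₀ G₁ true t q l θ' θ)

/-- The `q`-value of the edge `e`, for the clustering `z` and the parameter `θ`. -/
def qvalue {n : ℕ} (x : Obs n) (z : Fin n → Fin Q) (θ : Param Q d₀ d₁) (e : Edge n) : ℝ :=
  mfdr G₀ G₁ θ θ (lvalue G₀ G₁ x z θ e)

/-- The procedure that rejects the edges whose `q`-value, for the estimated clustering and the
estimated parameter, is at most `α`. -/
def plugIn {n : ℕ} (θhat : Obs n → Param Q d₀ d₁) (Zhat : Obs n → Fin n → Fin Q) (α : ℝ)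
    (x : Obs n) (e : Edge n) : ℝ :=
  if qvalue G₀ G₁ x (Zhat x) (θhat x) e ≤ α then 1 else 0

/-- The oracle procedure `φ*`: rejection of the edges whose `q`-value, for the true clustering
`Z` and the true parameter `θ₀`, is at most `α`. -/
def oracle {n : ℕ} (θ₀ : Param Q d₀ d₁) (α : ℝ) (s : Sample n Q) (e : Edge n) : ℝ :=
  if qvalue G₀ G₁ s.2.2 s.1 θ₀ e ≤ α then 1 else 0

/-- The true discovery rate of `φ` under `P_θ` (`φ` may depend on the whole sample, as the oracle
procedure does). -/
def tdr {n : ℕ} (θ : Param Q d₀ d₁) (φ : Sample n Q → Edge n → ℝ) : ℝ :=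
  (∫ s, ∑ e, (if s.2.1 e then 1 else 0) * φ s e ∂(law G₀ G₁ n θ)) /
    ∫ s, ∑ e, (if s.2.1 e then (1 : ℝ) else 0) ∂(law G₀ G₁ n θ)

/-- The generalized inverse `T_θ(y) = max {t ∈ [0,1] : Q_θ(θ, t) ≤ y}`. -/
def thr (θ : Param Q d₀ d₁) (y : ℝ) : ℝ :=
  sSup {t | t ∈ Icc (0 : ℝ) 1 ∧ mfdr G₀ G₁ θ θ t ≤ y}

/-- The regularity assumption, for the functions `t₁ q l = t_{1,q,l}` and `t₂ q l = t_{2,q,l}`. -/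
structure Regularity (Θ : Set (Param Q d₀ d₁)) (t₁ t₂ : Fin Q → Fin Q → Param Q d₀ d₁ → ℝ) :
    Prop where
  continuousOn : ∀ δ q l, ContinuousOn
    (fun p : ℝ × Param Q d₀ d₁ × Param Q d₀ d₁ => qfun G₀ G₁ δ p.1 q l p.2.2 p.2.1)
    (Icc (0 : ℝ) 1 ×ˢ Θ ×ˢ Θ)
  bounds : ∀ q l, ∀ θ ∈ Θ, 0 ≤ t₁ q l θ ∧ t₁ q l θ < t₂ q l θ ∧ t₂ q l θ ≤ 1
  continuousOn_t : ∀ δ q l, ∀ θ ∈ Θ, ∀ θ₀ ∈ Θ,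
    ContinuousOn (fun t => qfun G₀ G₁ δ t q l θ₀ θ) (Icc 0 1)
  eq_zero : ∀ δ q l, ∀ θ ∈ Θ, ∀ θ₀ ∈ Θ, ∀ t ∈ Icc 0 (t₁ q l θ), qfun G₀ G₁ δ t q l θ₀ θ = 0
  increasing : ∀ δ q l, ∀ θ ∈ Θ, ∀ θ₀ ∈ Θ,
    StrictMonoOn (fun t => qfun G₀ G₁ δ t q l θ₀ θ) (Icc (t₁ q l θ) (t₂ q l θ))
  eq_one : ∀ δ q l, ∀ θ ∈ Θ, ∀ θ₀ ∈ Θ, ∀ t ∈ Icc (t₂ q l θ) 1, qfun G₀ G₁ δ t q l θ₀ θ = 1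

/-- The critical level `α_*(θ)`, the limit of `Q_θ(θ, t)` as `t` decreases to
`t₁(θ) = min_{q,l} t_{1,q,l}(θ)`. -/
def alphaStar (t₁ : Fin Q → Fin Q → Param Q d₀ d₁ → ℝ) (θ : Param Q d₀ d₁) : ℝ :=
  Function.rightLim (mfdr G₀ G₁ θ θ) (⨅ p : Fin Q × Fin Q, t₁ p.1 p.2 θ)

/-- `S` is a union of `K` pairwise disjoint intervals of `ℝ`. They may be empty, bounded or not,
and contain their end points or not. -/
def IsUnionOfIntervals (K : ℕ) (S : Set ℝ) : Prop :=
  ∃ J : Fin K → Set ℝ, (∀ k, (J k).OrdConnected) ∧ Pairwise (fun k k' => Disjoint (J k) (J k')) ∧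
    S = ⋃ k, J k

/-- The complexity assumption: `{ℓ(X_{i,j}, q, l; θ) ≤ t} = {X_{i,j} ∈ I}` for a union `I` of `K`
intervals. -/
def Complexity (Θ : Set (Param Q d₀ d₁)) (K : ℕ) : Prop :=
  ∀ θ ∈ Θ, ∀ q l, ∀ t ∈ Icc (0 : ℝ) 1, IsUnionOfIntervals K {x | lfun G₀ G₁ x q l θ ≤ t}

/-- The constant `κ`, for a compact interval `𝒦` with left end point `a = min 𝒦`. -/
def kappa (θ₀ : Param Q d₀ d₁) (a : ℝ) : ℝ :=
  ∑ q, ∑ l, θ₀.grp q * θ₀.grp l *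
    ((1 - θ₀.con q l) * qfun G₀ G₁ false (thr G₀ G₁ θ₀ a) q l θ₀ θ₀ +
      θ₀.con q l * qfun G₀ G₁ true (thr G₀ G₁ θ₀ a) q l θ₀ θ₀)

/-- The modulus `𝒲_{α,T}` of `T_{θ₀}` at `α`. -/
def modT (θ₀ : Param Q d₀ d₁) (α : ℝ) (𝒦 : Set ℝ) (u : ℝ) : ℝ :=
  sSup {r | ∃ y ∈ 𝒦, |y - α| ≤ u ∧ r = |thr G₀ G₁ θ₀ y - thr G₀ G₁ θ₀ α|}

/-- The modulus `𝒲_{T,𝒒₁}` of `𝒒₁(·, q, l; θ₀, θ₀)` at `T_{θ₀}(α)`. -/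
def modq1 (θ₀ : Param Q d₀ d₁) (α : ℝ) (𝒦 : Set ℝ) (u : ℝ) : ℝ :=
  sSup {r | ∃ q l, ∃ t ∈ thr G₀ G₁ θ₀ '' 𝒦, |t - thr G₀ G₁ θ₀ α| ≤ u ∧
    r = |qfun G₀ G₁ true t q l θ₀ θ₀ - qfun G₀ G₁ true (thr G₀ G₁ θ₀ α) q l θ₀ θ₀|}

/-- The modulus `𝒲_{θ₀,𝒒}` of `(θ', θ) ↦ 𝒒_δ(t, q, l; θ', θ)` at `(θ₀, θ₀)`, uniform over
`t ∈ T_{θ₀}(𝒦)`. -/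
def modq (Θ : Set (Param Q d₀ d₁)) (θ₀ : Param Q d₀ d₁) (𝒦 : Set ℝ) (u : ℝ) : ℝ :=
  sSup {r | ∃ q l, ∃ t ∈ thr G₀ G₁ θ₀ '' 𝒦, ∃ δ, ∃ θ ∈ Θ, ∃ θ' ∈ Θ,
    ‖θ - θ₀‖ ≤ u ∧ ‖θ' - θ₀‖ ≤ u ∧
    r = |qfun G₀ G₁ δ t q l θ' θ - qfun G₀ G₁ δ t q l θ₀ θ₀|}

/-- `‖(θ', z') - (θ, z)‖`, the minimum over the permutations `σ` of the labels of
`max (‖θ'^σ - θ‖_∞, ‖z' - z^σ‖_∞)`, where `z^σ = (σ(z_i))_i`. -/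
def pairDist {n : ℕ} (θ' : Param Q d₀ d₁) (z' : Fin n → Fin Q) (θ : Param Q d₀ d₁)
    (z : Fin n → Fin Q) : ℝ :=
  ⨅ σ : Equiv.Perm (Fin Q),
    max ‖θ'.relabel σ - θ‖ ‖fun i => ((z' i : ℕ) : ℝ) - ((σ (z i) : ℕ) : ℝ)‖

end NSBM

end

/-!
The two exponential terms leave so much room that no exponential inequality is needed: second
moments suffice. Let `m = n (n - 1) / 2`. If `x` plus the two exponential terms is at least `1`, the
right-hand side is nonpositive and there is nothing to prove. Otherwise `n x ^ 2` and
`m x ^ 2 / (K Q) ^ 2` are so large that `4 K Q / √m + 1 / (2 √n) ≤ x` (`rate_le`), and it is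
enough to prove the inequality with `x` and the exponential terms replaced by these two rates
(`pi1_mul_tdr_oracle_le`).

*Threshold.* Since the `ℓ`-value is a conditional probability, `mfdr θ θ` is nondecreasing
(`mfdr_mono`). As a ratio of averages with denominator at least `κ`, it is stable under small
changes of `θ`, so for `θ` close to `θ₀` the `q`-value procedure rejects all `ℓ`-values below
`t = T_{θ₀}(α - u)`, where `u` is the argument of the modulus `modT`; the power lost between `t` and
`T_{θ₀}(α)` is at most `modq + modq1` (`exists_uniform_threshold`). The radius `e` makes
`α - u` stay in the compact interval, and it exists because `modq` tends to `0`
(`exists_modq_le`).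

*Empirical process.* The estimated parameter depends on the data, so the number of detections
`ℓ(X_e, Z; θ) ≤ t` has to be controlled uniformly in `θ`. Given `(Z, A)`, for each pair of groups
these are counts of independent points in unions of `K` intervals. Symmetrization, and the maximal
inequality for a random walk proved by a one-step recursion on second moments, bound the mean of the
uniform error of `N` points by `4 K √N` (`exists_empirical_bound`), in total by `4 K Q √m`.

*Bad event.* On the event that the estimators are far from the truth at most all the edges are
lost. Its contribution is `𝝅₁` times its probability, up to the mean of the positive part of the
centered number of edges divided by `m`, which is at most `1 / (2 √n)` since only edges with a
common vertex are correlated (`latentMean_excess_edges_le`).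
-/

namespace NSBM

/-! ### Random signs and uniform deviations over unions of intervals -/

/-- The sign `±1` encoded by a Boolean. -/
def sgn (b : Bool) : ℝ := if b then 1 else -1

theorem sgn_sq (b : Bool) : sgn b ^ 2 = 1 := by cases b <;> simp [sgn]

theorem sgn_not (b : Bool) : sgn (!b) = -sgn b := by cases b <;> simp [sgn]

section Signs

variable {ι : Type*}

theorem sum_sgn_mul_eq_zero [Fintype ι] [DecidableEq ι] (i : ι) (R : (ι → Bool) → ℝ)
    (hR : ∀ ε, R (Function.update ε i (!ε i)) = R ε) : ∑ ε, sgn (ε i) * R ε = 0 := by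
  have hinv : Function.Involutive fun ε : ι → Bool => Function.update ε i (!ε i) := by
    intro ε; simp
  have h := (Equiv.sum_comp hinv.toPerm fun ε => sgn (ε i) * R ε)
  simp only [Function.Involutive.coe_toPerm, Function.update_self, sgn_not, hR, neg_mul,
    Finset.sum_neg_distrib] at h
  linarith

/-- Maximal inequality for random signs. Summed over the initial segments of the points `y i`
(`i ∈ I`), the signs form a random walk; peeling off the smallest point, the maximum `R` of the walk
satisfies `R = max 0 (± 1 + R')` with `R'` independent of the sign, so that the mean of `R ^ 2`
grows by at most `1` with each point. The second property says that `R` depends on the signs in `I`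
only. -/
theorem exists_prefixSum_bound [Fintype ι] [DecidableEq ι] (y : ι → ℝ) (I : Finset ι) :
    ∃ R : (ι → Bool) → ℝ, (∀ ε, 0 ≤ R ε) ∧
      (∀ ε ε', (∀ i ∈ I, ε i = ε' i) → R ε = R ε') ∧
      ∑ ε, R ε ^ 2 ≤ I.card * Fintype.card (ι → Bool) ∧
      ∀ U : Set ℝ, IsLowerSet U → ∀ ε, ∑ i ∈ I, sgn (ε i) * U.indicator 1 (y i) ≤ R ε := by
  induction I using Finset.induction_on_min_value y with
  | empty => exact ⟨fun _ => 0, by simp, by simp, by simp, by simp⟩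
  | insert i I hi hmin ih =>
    obtain ⟨R, hR0, hRdep, hRsq, hR⟩ := ih
    refine ⟨fun ε => max 0 (sgn (ε i) + R ε), fun ε => le_max_left _ _, ?_, ?_, ?_⟩
    · intro ε ε' h
      simp only
      rw [h i (by simp), hRdep ε ε' fun j hj => h j (by simp [hj])]
    · have hz := sum_sgn_mul_eq_zero i R fun ε => hRdep _ _ fun j hj => by
        rw [Function.update_of_ne]; rintro rfl; exact hi hj
      have : ∀ ε : ι → Bool, max 0 (sgn (ε i) + R ε) ^ 2
          ≤ 1 + 2 * (sgn (ε i) * R ε) + R ε ^ 2 := by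
        intro ε
        have h1 := sgn_sq (ε i)
        rcases max_cases 0 (sgn (ε i) + R ε) with ⟨h, _⟩ | ⟨h, _⟩ <;> rw [h] <;>
          nlinarith [sq_nonneg (sgn (ε i) + R ε)]
      refine (Finset.sum_le_sum fun ε _ => this ε).trans ?_
      rw [Finset.sum_add_distrib, Finset.sum_add_distrib, ← Finset.mul_sum, hz,
        Finset.card_insert_of_notMem hi]
      simp only [Finset.sum_const, Finset.card_univ, nsmul_eq_mul]
      push_cast
      linarith
    · intro U hU ε
      rw [Finset.sum_insert hi]
      by_cases hy : y i ∈ U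
      · refine le_max_of_le_right ?_
        rw [indicator_of_mem hy]
        simpa using hR U hU ε
      · refine le_max_of_le_left (le_of_eq ?_)
        rw [indicator_of_notMem hy, Finset.sum_eq_zero]
        · simp
        · intro j hj
          rw [indicator_of_notMem (fun h => hy (hU (hmin j hj) h)), mul_zero]

theorem exists_prefixSum_mean_bound [Fintype ι] [DecidableEq ι] (y : ι → ℝ) (I : Finset ι) :
    ∃ R : (ι → Bool) → ℝ,
      ∑ ε, R ε ≤ √I.card * Fintype.card (ι → Bool) ∧
      ∀ U : Set ℝ, IsLowerSet U → ∀ ε, ∑ i ∈ I, sgn (ε i) * U.indicator 1 (y i) ≤ R ε := by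
  obtain ⟨R, -, -, hsq, hR⟩ := exists_prefixSum_bound y I
  refine ⟨R, abs_le_of_sq_le_sq' ?_ (by positivity) |>.2, hR⟩
  rw [mul_pow, Real.sq_sqrt (by positivity)]
  have h := sq_sum_le_card_mul_sum_sq (s := Finset.univ) (f := R)
  rw [Finset.card_univ] at h
  nlinarith [mul_le_mul_of_nonneg_left hsq (Nat.cast_nonneg (α := ℝ) (Fintype.card (ι → Bool)))]

/-- The maximal excess of the number of points of `x'` over the number of points of `x` on a
lower set of `ℝ`, for the points with index in `I`. The lower sets `(-∞, x'_j]` and `∅` suffice. -/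
noncomputable def maxExcess (I : Finset ι) (x x' : ι → ℝ) : ℝ :=
  ⨆ j : Option ι, j.elim 0 fun j =>
    ∑ i ∈ I, ((Iic (x' j)).indicator 1 (x' i) - (Iic (x' j)).indicator 1 (x i))

theorem le_maxExcess [Fintype ι] (I : Finset ι) (x x' : ι → ℝ) {U : Set ℝ} (hU : IsLowerSet U) :
    ∑ i ∈ I, (U.indicator 1 (x' i) - U.indicator 1 (x i)) ≤ maxExcess I x x' := by
  classical
  have key : ∃ j : Option ι, ∑ i ∈ I, (U.indicator 1 (x' i) - U.indicator 1 (x i)) ≤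
      j.elim (0 : ℝ) fun j =>
        ∑ i ∈ I, ((Iic (x' j)).indicator 1 (x' i) - (Iic (x' j)).indicator 1 (x i)) := by
    rcases (I.filter fun i => x' i ∈ U).eq_empty_or_nonempty with h | h
    · refine ⟨none, Finset.sum_nonpos fun i hi => ?_⟩
      have hi' : x' i ∉ U := fun h' => by
        have : i ∈ I.filter fun i => x' i ∈ U := Finset.mem_filter.2 ⟨hi, h'⟩
        rw [h] at this; simp at this
      rw [indicator_of_notMem hi', zero_sub, neg_nonpos]
      exact indicator_nonneg (fun _ _ => zero_le_one) _
    · obtain ⟨j, hj, hmax⟩ := Finset.exists_max_image _ x' h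
      rw [Finset.mem_filter] at hj
      refine ⟨some j, Finset.sum_le_sum fun i hi => sub_le_sub ?_ ?_⟩
      · by_cases h' : x' i ∈ U
        · have : x' i ∈ Iic (x' j) := hmax i (Finset.mem_filter.2 ⟨hi, h'⟩)
          rw [indicator_of_mem h', indicator_of_mem this]
        · rw [indicator_of_notMem h']
          exact indicator_nonneg (fun _ _ => zero_le_one) _
      · exact indicator_le_indicator_of_subset (fun t ht => hU ht hj.2)
          (fun _ => zero_le_one) _
  obtain ⟨j, hj⟩ := key
  exact hj.trans (le_ciSup (f := fun j : Option ι => j.elim (0 : ℝ) fun j =>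
        ∑ i ∈ I, ((Iic (x' j)).indicator 1 (x' i) - (Iic (x' j)).indicator 1 (x i)))
        (Set.finite_range _).bddAbove j)

theorem maxExcess_le (I : Finset ι) (x x' : ι → ℝ) {B : ℝ}
    (h : ∀ U : Set ℝ, IsLowerSet U →
      ∑ i ∈ I, (U.indicator 1 (x' i) - U.indicator 1 (x i)) ≤ B) : maxExcess I x x' ≤ B := by
  refine ciSup_le fun j => ?_
  cases j with
  | none => simpa using h ∅ isLowerSet_empty
  | some j => exact h _ (isLowerSet_Iic _)

theorem maxExcess_nonneg [Fintype ι] (I : Finset ι) (x x' : ι → ℝ) : 0 ≤ maxExcess I x x' := by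
  simpa using le_maxExcess I x x' isLowerSet_empty

theorem maxExcess_le_card [Fintype ι] (I : Finset ι) (x x' : ι → ℝ) :
    maxExcess I x x' ≤ I.card := by
  refine maxExcess_le I x x' fun U _ => ?_
  rw [Finset.cast_card]
  refine Finset.sum_le_sum fun i _ => ?_
  have h1 : U.indicator (1 : ℝ → ℝ) (x' i) ≤ 1 := indicator_le_self' (fun _ _ => zero_le_one) _
  have h2 : 0 ≤ U.indicator (1 : ℝ → ℝ) (x i) := indicator_nonneg (fun _ _ => zero_le_one) _
  linarith

theorem measurable_maxExcess [Fintype ι] (I : Finset ι) :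
    Measurable fun p : (ι → ℝ) × (ι → ℝ) => maxExcess I p.1 p.2 := by
  refine Measurable.iSup fun j => ?_
  cases j with
  | none => exact measurable_const
  | some j =>
    refine Finset.measurable_sum _ fun i _ => ?_
    have e : ∀ s t : ℝ, (Iic s).indicator (1 : ℝ → ℝ) t = if t ≤ s then 1 else 0 := by
      intro s t; simp [indicator_apply]
    simp only [e]
    refine Measurable.sub ?_ ?_
    · exact Measurable.ite (measurableSet_le (by fun_prop) (by fun_prop)) measurable_const
        measurable_const
    · exact Measurable.ite (measurableSet_le (by fun_prop) (by fun_prop)) measurable_const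
        measurable_const

/-- Exchange of `x_i` and `x'_i` for the indices `i` with `ε i = false`. -/
def exchange (ε : ι → Bool) (p : (ι → ℝ) × (ι → ℝ)) : (ι → ℝ) × (ι → ℝ) :=
  (fun i => if ε i then p.1 i else p.2 i, fun i => if ε i then p.2 i else p.1 i)

/-- After a random exchange of `x` and `x'`, the mean of `maxExcess` is at most `2 √|I|`: the excess
on a lower set is a difference of two sums of random signs over initial segments. -/
theorem sum_maxExcess_exchange_le [Fintype ι] [DecidableEq ι] (I : Finset ι)
    (p : (ι → ℝ) × (ι → ℝ)) :
    ∑ ε, maxExcess I (exchange ε p).1 (exchange ε p).2 ≤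
      2 * √I.card * Fintype.card (ι → Bool) := by
  obtain ⟨R, hRm, hR⟩ := exists_prefixSum_mean_bound p.1 I
  obtain ⟨R', hRm', hR'⟩ := exists_prefixSum_mean_bound p.2 I
  have hflip : ∑ ε : ι → Bool, R (fun i => !ε i) = ∑ ε, R ε := by
    have hinv : Function.Involutive fun (ε : ι → Bool) i => !ε i := by intro ε; simp
    exact Equiv.sum_comp hinv.toPerm R
  have h : ∀ ε : ι → Bool, maxExcess I (exchange ε p).1 (exchange ε p).2 ≤
      R' ε + R fun i => !ε i := by
    intro ε
    refine maxExcess_le I _ _ fun U hU => ?_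
    have h1 := hR' U hU ε
    have h2 := hR U hU fun i => !ε i
    refine le_trans (le_of_eq ?_) (add_le_add h1 h2)
    rw [← Finset.sum_add_distrib]
    refine Finset.sum_congr rfl fun i _ => ?_
    cases hε : ε i <;> simp [exchange, hε, sgn] <;> ring
  calc _ ≤ ∑ ε : ι → Bool, (R' ε + R fun i => !ε i) := Finset.sum_le_sum fun ε _ => h ε
    _ = ∑ ε, R' ε + ∑ ε, R ε := by rw [Finset.sum_add_distrib, hflip]
    _ ≤ _ := by linarith

variable [Fintype ι] (μ : ι → Measure ℝ) [∀ i, IsProbabilityMeasure (μ i)]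

theorem measurePreserving_exchange (ε : ι → Bool) :
    MeasurePreserving (exchange ε) ((Measure.pi μ).prod (Measure.pi μ))
      ((Measure.pi μ).prod (Measure.pi μ)) := by
  have he := measurePreserving_arrowProdEquivProdArrow ℝ ℝ ι μ μ
  have hs : ∀ i, MeasurePreserving (if ε i then id else Prod.swap) ((μ i).prod (μ i))
      ((μ i).prod (μ i)) := by
    intro i
    cases ε i
    · simpa using Measure.measurePreserving_swap
    · simpa using MeasurePreserving.id _
  have hp := measurePreserving_pi (fun i => (μ i).prod (μ i)) (fun i => (μ i).prod (μ i)) hs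
  have := he.comp (hp.comp he.symm)
  convert this using 1
  funext p
  refine Prod.ext ?_ ?_ <;> funext i <;> cases hε : ε i <;>
    simp [exchange, MeasurableEquiv.arrowProdEquivProdArrow, Equiv.arrowProdEquivProdArrow, hε]

theorem integrable_maxExcess (I : Finset ι) :
    Integrable (fun p : (ι → ℝ) × (ι → ℝ) => maxExcess I p.1 p.2)
      ((Measure.pi μ).prod (Measure.pi μ)) := by
  refine Integrable.of_bound (measurable_maxExcess I).aestronglyMeasurable I.card
    (ae_of_all _ fun p => ?_)
  rw [Real.norm_of_nonneg (maxExcess_nonneg I _ _)]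
  exact maxExcess_le_card I _ _

theorem integral_maxExcess_le (I : Finset ι) :
    ∫ p, maxExcess I p.1 p.2 ∂((Measure.pi μ).prod (Measure.pi μ)) ≤ 2 * √I.card := by
  classical
  have hint := integrable_maxExcess μ I
  have h1 : ∀ ε : ι → Bool,
      ∫ p, maxExcess I (exchange ε p).1 (exchange ε p).2 ∂((Measure.pi μ).prod (Measure.pi μ)) =
        ∫ p, maxExcess I p.1 p.2 ∂((Measure.pi μ).prod (Measure.pi μ)) := by
    intro ε
    have hm := measurePreserving_exchange μ ε
    conv_rhs => rw [← hm.map_eq]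
    rw [integral_map hm.measurable.aemeasurable (measurable_maxExcess I).aestronglyMeasurable]
  have h2 := integral_mono (μ := (Measure.pi μ).prod (Measure.pi μ))
    (integrable_finsetSum Finset.univ fun ε _ =>
      ((measurePreserving_exchange μ ε).integrable_comp_of_integrable hint))
    (integrable_const _) (fun p => sum_maxExcess_exchange_le I p)
  rw [integral_const] at h2
  simp only [Function.comp_def] at h2
  have h3 := integral_finsetSum (μ := (Measure.pi μ).prod (Measure.pi μ)) Finset.univ fun ε _ =>
      ((measurePreserving_exchange μ ε).integrable_comp_of_integrable hint)
  simp only [Function.comp_def] at h3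
  rw [h3] at h2
  simp only [h1, Finset.sum_const, Finset.card_univ, nsmul_eq_mul,
    probReal_univ, smul_eq_mul, one_mul] at h2
  have hc : (0 : ℝ) < Fintype.card (ι → Bool) := by exact_mod_cast Fintype.card_pos
  rw [mul_comm] at h2
  exact le_of_mul_le_mul_right h2 hc

theorem integrable_indicator_eval (i : ι) {S : Set ℝ} (hS : MeasurableSet S) :
    Integrable (fun x : ι → ℝ => S.indicator (1 : ℝ → ℝ) (x i)) (Measure.pi μ) :=
  (measurePreserving_eval μ i).integrable_comp_of_integrable
    (g := S.indicator (1 : ℝ → ℝ)) ((integrable_const (1 : ℝ)).indicator hS)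

theorem integral_indicator_eval (i : ι) {S : Set ℝ} (hS : MeasurableSet S) :
    ∫ x, S.indicator (1 : ℝ → ℝ) (x i) ∂(Measure.pi μ) = (μ i).real S := by
  have hmp := measurePreserving_eval μ i
  rw [← integral_indicator_one hS]
  conv_rhs => rw [← hmp.map_eq]
  rw [integral_map hmp.measurable.aemeasurable]
  exact (measurable_one.indicator hS).aestronglyMeasurable

/-- An interval is the difference of two nested lower sets. -/
theorem sum_indicator_sub_le_of_ordConnected (I : Finset ι) (x x' : ι → ℝ) {J : Set ℝ}
    (hJ : J.OrdConnected) :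
    ∑ i ∈ I, (J.indicator 1 (x' i) - J.indicator 1 (x i)) ≤
      maxExcess I x x' + maxExcess I x' x := by
  set U : Set ℝ := ↑(lowerClosure J)
  have hU : IsLowerSet U := (lowerClosure J).lower
  have hJU : J ⊆ U := subset_lowerClosure
  have hL : IsLowerSet (U \ J) := by
    intro s t hts hs
    refine ⟨hU hts hs.1, fun htJ => hs.2 ?_⟩
    obtain ⟨r, hrJ, hsr⟩ := mem_lowerClosure.1 hs.1
    exact hJ.out htJ hrJ ⟨hts, hsr⟩
  have e : ∀ t, J.indicator (1 : ℝ → ℝ) t = U.indicator 1 t - (U \ J).indicator 1 t := by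
    intro t
    by_cases h : t ∈ J
    · rw [indicator_of_mem h, indicator_of_mem (hJU h), indicator_of_notMem fun h' => h'.2 h,
        sub_zero]
    · by_cases h' : t ∈ U
      · rw [indicator_of_notMem h, indicator_of_mem h',
          indicator_of_mem (show t ∈ U \ J from ⟨h', h⟩),
          sub_self]
      · rw [indicator_of_notMem h, indicator_of_notMem h', indicator_of_notMem fun h'' => h' h''.1,
          sub_zero]
  have h1 := le_maxExcess I x x' hU
  have h2 := le_maxExcess I x' x hL
  refine le_trans (le_of_eq ?_) (add_le_add h1 h2)
  rw [← Finset.sum_add_distrib]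
  exact Finset.sum_congr rfl fun i _ => by rw [e, e]; ring

theorem IsUnionOfIntervals.measurableSet {K : ℕ} {S : Set ℝ} (hS : IsUnionOfIntervals K S) :
    MeasurableSet S := by
  obtain ⟨J, hJ, -, rfl⟩ := hS
  exact MeasurableSet.iUnion fun k => (hJ k).measurableSet

theorem sum_indicator_sub_le_of_isUnionOfIntervals (I : Finset ι) (x x' : ι → ℝ) {K : ℕ}
    {S : Set ℝ} (hS : IsUnionOfIntervals K S) :
    ∑ i ∈ I, (S.indicator 1 (x' i) - S.indicator 1 (x i)) ≤
      K * (maxExcess I x x' + maxExcess I x' x) := by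
  obtain ⟨J, hJ, hd, rfl⟩ := hS
  have e : ∀ t, (⋃ k, J k).indicator (1 : ℝ → ℝ) t = ∑ k, (J k).indicator 1 t := by
    intro t
    by_cases ht : t ∈ ⋃ k, J k
    · obtain ⟨k, hk⟩ := mem_iUnion.1 ht
      rw [indicator_of_mem ht, Finset.sum_eq_single k, indicator_of_mem hk]
      · intro k' _ hk'
        exact indicator_of_notMem (fun h => (hd hk').le_bot ⟨h, hk⟩) _
      · simp
    · rw [indicator_of_notMem ht, Finset.sum_eq_zero]
      intro k _
      exact indicator_of_notMem (fun h => ht (mem_iUnion.2 ⟨k, h⟩)) _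
  simp only [e, ← Finset.sum_sub_distrib]
  rw [Finset.sum_comm]
  calc _ ≤ ∑ _k : Fin K, (maxExcess I x x' + maxExcess I x' x) :=
        Finset.sum_le_sum fun k _ => sum_indicator_sub_le_of_ordConnected I x x' (hJ k)
    _ = _ := by rw [Finset.sum_const, Finset.card_univ, Fintype.card_fin, nsmul_eq_mul]

/-- Uniform deviation, over the unions of `K` intervals, of the number of points from its mean, for
independent (not necessarily identically distributed) points. The deviation is bounded by an
integrable variable `B`, namely the mean of a multiple of `maxExcess` over an independent copy of
the points, which avoids the measurability of a supremum over sets. -/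
theorem exists_empirical_bound (I : Finset ι) (K : ℕ) :
    ∃ B : (ι → ℝ) → ℝ, Integrable B (Measure.pi μ) ∧ (∀ x, 0 ≤ B x) ∧
      ∫ x, B x ∂(Measure.pi μ) ≤ 4 * K * √I.card ∧
      ∀ S, IsUnionOfIntervals K S → ∀ x,
        ∑ i ∈ I, ((μ i).real S - S.indicator 1 (x i)) ≤ B x := by
  set P := Measure.pi μ
  have hi1 : Integrable (fun p : (ι → ℝ) × (ι → ℝ) => maxExcess I p.1 p.2) (P.prod P) :=
    integrable_maxExcess μ I
  have hi2 : Integrable (fun p : (ι → ℝ) × (ι → ℝ) => maxExcess I p.2 p.1) (P.prod P) :=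
    hi1.swap
  have hi : Integrable (fun p : (ι → ℝ) × (ι → ℝ) =>
      (K : ℝ) * (maxExcess I p.1 p.2 + maxExcess I p.2 p.1)) (P.prod P) :=
    (hi1.add hi2).const_mul _
  have hx : ∀ x, Integrable (fun x' =>
      (K : ℝ) * (maxExcess I x x' + maxExcess I x' x)) P := by
    intro x
    refine Integrable.const_mul (Integrable.add ?_ ?_) _
    · refine Integrable.of_bound ((measurable_maxExcess I).comp
        measurable_prodMk_left).aestronglyMeasurable I.card (ae_of_all _ fun p => ?_)
      rw [Real.norm_of_nonneg (maxExcess_nonneg I _ _)]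
      exact maxExcess_le_card I _ _
    · refine Integrable.of_bound ((measurable_maxExcess I).comp
        measurable_prodMk_right).aestronglyMeasurable I.card (ae_of_all _ fun p => ?_)
      rw [Real.norm_of_nonneg (maxExcess_nonneg I _ _)]
      exact maxExcess_le_card I _ _
  refine ⟨fun x => ∫ x', (K : ℝ) * (maxExcess I x x' + maxExcess I x' x) ∂P,
    hi.integral_prod_left, fun x => integral_nonneg fun x' =>
      mul_nonneg (Nat.cast_nonneg K)
        (add_nonneg (maxExcess_nonneg I x x') (maxExcess_nonneg I x' x)), ?_, ?_⟩
  · rw [← integral_prod _ hi, integral_const_mul, integral_add hi1 hi2]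
    have h1 : ∫ p, maxExcess I p.1 p.2 ∂(P.prod P) ≤ 2 * √I.card := integral_maxExcess_le μ I
    have h2 : ∫ p, maxExcess I p.2 p.1 ∂(P.prod P) ≤ 2 * √I.card := by
      refine le_trans (le_of_eq ?_) h1
      exact integral_prod_swap (μ := P) (ν := P)
        (fun p : (ι → ℝ) × (ι → ℝ) => maxExcess I p.1 p.2)
    nlinarith [mul_le_mul_of_nonneg_left (add_le_add h1 h2) (Nat.cast_nonneg (α := ℝ) K)]
  · intro S hS x
    have hev := fun i => integrable_indicator_eval μ i hS.measurableSet
    have : ∑ i ∈ I, ((μ i).real S - S.indicator 1 (x i)) =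
        ∫ x', ∑ i ∈ I, (S.indicator (1 : ℝ → ℝ) (x' i) - S.indicator 1 (x i)) ∂P := by
      have h := integral_finsetSum (μ := P) I fun i _ =>
        (hev i).sub (integrable_const (S.indicator (1 : ℝ → ℝ) (x i)))
      simp only [Pi.sub_apply] at h
      rw [h]
      refine Finset.sum_congr rfl fun i _ => ?_
      rw [integral_sub (hev i) (integrable_const _), integral_indicator_eval μ i hS.measurableSet]
      simp
    rw [this]
    exact integral_mono (integrable_finsetSum _ fun i _ => (hev i).sub (integrable_const _))
      (hx x) fun x' => sum_indicator_sub_le_of_isUnionOfIntervals I x x' hS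

end Signs

/-! ### Moments of the number of edges -/

/-- Under a product of finite probability vectors, functions of distinct coordinates are
independent. -/
theorem sum_prod_mul_prod {ι C : Type*} [Fintype ι] [DecidableEq ι] [Fintype C]
    (p : ι → C → ℝ) (hp : ∀ i, ∑ c, p i c = 1) (S : Finset ι) (h : ι → C → ℝ) :
    ∑ z : ι → C, (∏ i, p i (z i)) * ∏ i ∈ S, h i (z i) = ∏ i ∈ S, ∑ c, p i c * h i c := by
  have h1 : ∀ z : ι → C, (∏ i, p i (z i)) * ∏ i ∈ S, h i (z i) =
      ∏ i, p i (z i) * (if i ∈ S then h i (z i) else 1) := by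
    intro z
    rw [Finset.prod_mul_distrib]
    simp
  have h2 : ∏ i ∈ S, ∑ c, p i c * h i c =
      ∏ i, ∑ c, p i c * (if i ∈ S then h i c else 1) := by
    rw [← Finset.prod_filter_mul_prod_filter_not Finset.univ (fun i => i ∈ S)]
    have h3 : ∏ i with i ∉ S, ∑ c, p i c * (if i ∈ S then h i c else 1) = 1 := by
      refine Finset.prod_eq_one fun i hi => ?_
      simp [(Finset.mem_filter.1 hi).2, hp]
    rw [h3, mul_one]
    refine Finset.prod_congr (by ext; simp) fun i hi => ?_
    have hi' : i ∈ S := by simpa using hi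
    simp [hi']
  rw [h2, Finset.prod_univ_sum, Fintype.piFinset_univ]
  exact Finset.sum_congr rfl fun z _ => h1 z

section Iid

variable {ι C : Type*} [Fintype ι] [DecidableEq ι] [Fintype C] [DecidableEq C]
  {p : C → ℝ}

theorem sum_prod_mul_pair (hp : ∑ c, p c = 1) {i j : ι} (hij : i ≠ j) (F : C → C → ℝ) :
    ∑ z : ι → C, (∏ k, p (z k)) * F (z i) (z j) = ∑ q, ∑ l, p q * p l * F q l := by
  have h1 : ∀ z : ι → C, (∏ k, p (z k)) * F (z i) (z j) =
      ∑ q, ∑ l, F q l * ((∏ k, p (z k)) * ∏ k ∈ ({i, j} : Finset ι),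
        if z k = (if k = i then q else l) then (1 : ℝ) else 0) := by
    intro z
    rw [Finset.sum_eq_single (z i), Finset.sum_eq_single (z j)]
    · rw [Finset.prod_pair hij]; simp [hij.symm]; ring
    · intro l _ hl; rw [Finset.prod_pair hij]; simp [hij.symm, hl.symm]
    · simp
    · intro q _ hq
      refine Finset.sum_eq_zero fun l _ => ?_
      rw [Finset.prod_pair hij]; simp [hq.symm]
    · simp
  simp only [h1]
  rw [Finset.sum_comm]
  refine Finset.sum_congr rfl fun q _ => ?_
  rw [Finset.sum_comm]
  refine Finset.sum_congr rfl fun l _ => ?_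
  rw [← Finset.mul_sum, sum_prod_mul_prod (fun _ => p) (fun _ => hp) {i, j}
    fun k c => if c = (if k = i then q else l) then (1 : ℝ) else 0, Finset.prod_pair hij]
  simp [hij.symm]
  ring

theorem sum_prod_mul_pair_mul_pair (hp : ∑ c, p c = 1) {i j i' j' : ι} (hij : i ≠ j)
    (hij' : i' ≠ j')
    (h1 : i ≠ i') (h2 : i ≠ j') (h3 : j ≠ i') (h4 : j ≠ j') (F F' : C → C → ℝ) :
    ∑ z : ι → C, (∏ k, p (z k)) * (F (z i) (z j) * F' (z i') (z j')) =
      (∑ q, ∑ l, p q * p l * F q l) * ∑ q, ∑ l, p q * p l * F' q l := by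
  have hprod : ∀ f : ι → ℝ, ∏ k ∈ ({i, j, i', j'} : Finset ι), f k = f i * f j * f i' * f j' := by
    intro f
    rw [Finset.prod_insert (by simp [hij, h1, h2]), Finset.prod_insert (by simp [h3, h4]),
      Finset.prod_pair hij']
    ring
  have e1 : ∀ z : ι → C, F (z i) (z j) = ∑ q, ∑ l, F q l *
      ((if z i = q then (1 : ℝ) else 0) * if z j = l then (1 : ℝ) else 0) := by
    intro z; simp
  have e2 : ∀ z : ι → C, F' (z i') (z j') = ∑ q, ∑ l, F' q l *
      ((if z i' = q then (1 : ℝ) else 0) * if z j' = l then (1 : ℝ) else 0) := by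
    intro z; simp
  have h5 : ∀ z : ι → C, (∏ k, p (z k)) * (F (z i) (z j) * F' (z i') (z j')) =
      ∑ q, ∑ l, ∑ q', ∑ l', F q l * F' q' l' * ((∏ k, p (z k)) *
        ∏ k ∈ ({i, j, i', j'} : Finset ι),
          if z k = (if k = i then q else if k = j then l else if k = i' then q' else l')
            then (1 : ℝ) else 0) := by
    intro z
    simp only [hprod]
    rw [e1, e2, Finset.sum_mul, Finset.mul_sum]
    refine Finset.sum_congr rfl fun q _ => ?_
    rw [Finset.sum_mul, Finset.mul_sum]
    refine Finset.sum_congr rfl fun l _ => ?_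
    rw [Finset.mul_sum, Finset.mul_sum]
    refine Finset.sum_congr rfl fun q' _ => ?_
    rw [Finset.mul_sum, Finset.mul_sum]
    refine Finset.sum_congr rfl fun l' _ => ?_
    simp only [hij.symm, h1.symm, h2.symm, h3.symm, h4.symm, hij'.symm, if_true, if_false]
    ring
  simp only [h5]
  rw [Finset.sum_comm, Finset.sum_mul]
  refine Finset.sum_congr rfl fun q _ => ?_
  rw [Finset.sum_comm, Finset.sum_mul]
  refine Finset.sum_congr rfl fun l _ => ?_
  rw [Finset.sum_comm, Finset.mul_sum]
  refine Finset.sum_congr rfl fun q' _ => ?_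
  rw [Finset.sum_comm, Finset.mul_sum]
  refine Finset.sum_congr rfl fun l' _ => ?_
  rw [← Finset.mul_sum, sum_prod_mul_prod (fun _ => p) (fun _ => hp) {i, j, i', j'}
    fun k c => if c = (if k = i then q else if k = j then l else if k = i' then q' else l')
      then (1 : ℝ) else 0, hprod]
  simp [hij.symm, h1.symm, h2.symm, h3.symm, h4.symm, hij'.symm]
  ring

end Iid

section Edges

theorem card_edge (n : ℕ) : (Fintype.card (Edge n) : ℝ) = n * (n - 1) / 2 := by
  have h : Fintype.card (Edge n) = ∑ i ∈ Finset.range n, i := by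
    rw [Fintype.card_subtype, Finset.card_filter, Fintype.sum_prod_type_right,
      ← Fin.sum_univ_eq_sum_range fun i => i]
    refine Finset.sum_congr rfl fun j _ => ?_
    rw [← Finset.card_filter]
    rw [← Fin.card_Iio j]
    congr 1
    ext; simp
  have h2 := Finset.sum_range_id_mul_two n
  rw [← h] at h2
  rcases n with _ | n
  · simp at h2 ⊢
  · have : ((Fintype.card (Edge (n + 1)) * 2 : ℕ) : ℝ) = ((n + 1) * n : ℕ) := by
      rw [h2]; simp
    push_cast at this ⊢
    linarith

theorem card_edge_incident_le {n : ℕ} (v : Fin n) :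
    (Finset.univ.filter fun e : Edge n => v = e.1.1 ∨ v = e.1.2).card ≤ n - 1 := by
  have h : (Finset.univ.erase v).card = n - 1 := by simp
  rw [← h]
  refine Finset.card_le_card_of_injOn (fun e => if v = e.1.1 then e.1.2 else e.1.1) ?_ ?_
  · intro e he
    have := e.2
    simp only [Finset.coe_filter, Finset.mem_univ, true_and, mem_ofPred_eq] at he
    rw [Finset.mem_coe, Finset.mem_erase]
    refine ⟨?_, Finset.mem_univ _⟩
    simp only
    split_ifs with h1
    · rw [h1]; exact this.ne'
    · exact fun h2 => h1 h2.symm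
  · intro e he e' he' hee
    have h1 := e.2
    have h2 := e'.2
    simp only [Finset.coe_filter, Finset.mem_univ, true_and, mem_ofPred_eq] at he he'
    refine Subtype.ext (Prod.ext ?_ ?_) <;> simp only at hee <;> split_ifs at hee <;> grind

end Edges

section Latent

variable {Q d₀ d₁ n : ℕ} {G₀ : DensityFamily d₀} {G₁ : DensityFamily d₁} {θ : Param Q d₀ d₁}

/-- The expectation of a function of `(Z, A)`. -/
noncomputable def latentMean (θ : Param Q d₀ d₁) (f : (Fin n → Fin Q) → (Edge n → Bool) → ℝ) : ℝ :=
  ∑ z, ∑ a, latentProb θ z a * f z a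

theorem latentProb_nonneg (hθ : θ ∈ admissible G₀ G₁) (z : Fin n → Fin Q) (a : Edge n → Bool) :
    0 ≤ latentProb θ z a := by
  refine mul_nonneg (Finset.prod_nonneg fun i _ => (hθ.1 _).le) (Finset.prod_nonneg fun e _ => ?_)
  have := hθ.2.2.1 (z e.1.1) (z e.1.2)
  split_ifs <;> linarith

theorem latentMean_mono (hθ : θ ∈ admissible G₀ G₁)
    {f g : (Fin n → Fin Q) → (Edge n → Bool) → ℝ} (h : ∀ z a, f z a ≤ g z a) :
    latentMean θ f ≤ latentMean θ g :=
  Finset.sum_le_sum fun z _ => Finset.sum_le_sum fun a _ =>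
    mul_le_mul_of_nonneg_left (h z a) (latentProb_nonneg hθ z a)

theorem latentMean_add (f g : (Fin n → Fin Q) → (Edge n → Bool) → ℝ) :
    latentMean θ (fun z a => f z a + g z a) = latentMean θ f + latentMean θ g := by
  simp only [latentMean, mul_add, Finset.sum_add_distrib]

theorem latentMean_const_mul (c : ℝ) (f : (Fin n → Fin Q) → (Edge n → Bool) → ℝ) :
    latentMean θ (fun z a => c * f z a) = c * latentMean θ f := by
  simp only [latentMean, Finset.mul_sum]
  exact Finset.sum_congr rfl fun _ _ => Finset.sum_congr rfl fun _ _ => by ring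

theorem latentMean_sum {κ : Type*} (s : Finset κ)
    (f : κ → (Fin n → Fin Q) → (Edge n → Bool) → ℝ) :
    latentMean θ (fun z a => ∑ k ∈ s, f k z a) = ∑ k ∈ s, latentMean θ (f k) := by
  simp only [latentMean, Finset.mul_sum]
  rw [Finset.sum_congr rfl fun z _ => Finset.sum_comm]
  exact Finset.sum_comm

/-- Integration of the edges: given `Z`, the `A_e` are independent with mean `w_{Z_i,Z_j}`. -/
theorem latentMean_mul_prod (g : (Fin n → Fin Q) → ℝ) (c : ℝ) (S : Finset (Edge n)) :
    latentMean θ (fun z a => g z * ∏ e ∈ S, ((if a e then (1 : ℝ) else 0) - c)) =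
      ∑ z : Fin n → Fin Q, (∏ i, θ.grp (z i)) *
        (g z * ∏ e ∈ S, (θ.con (z e.1.1) (z e.1.2) - c)) := by
  refine Finset.sum_congr rfl fun z _ => ?_
  have h := sum_prod_mul_prod (ι := Edge n) (C := Bool)
    (fun e b => if b then θ.con (z e.1.1) (z e.1.2) else 1 - θ.con (z e.1.1) (z e.1.2))
    (fun e => by simp) S (fun e b => (if b then (1 : ℝ) else 0) - c)
  have h' : ∀ e : Edge n, ∑ b : Bool, (if b then θ.con (z e.1.1) (z e.1.2) else
      1 - θ.con (z e.1.1) (z e.1.2)) * ((if b then (1 : ℝ) else 0) - c) =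
        θ.con (z e.1.1) (z e.1.2) - c := by
    intro e; simp; ring
  simp only [h'] at h
  rw [← h, Finset.mul_sum, Finset.mul_sum]
  exact Finset.sum_congr rfl fun a _ => by rw [latentProb]; ring

theorem sum_latentProb (hθ : θ ∈ admissible G₀ G₁) :
    ∑ z : Fin n → Fin Q, ∑ a : Edge n → Bool, latentProb θ z a = 1 := by
  have h := latentMean_mul_prod (n := n) (θ := θ) (fun _ => 1) 0 ∅
  have h2 := sum_prod_mul_prod (ι := Fin n) (fun _ => θ.grp) (fun _ => hθ.2.1) ∅ (fun _ _ => 1)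
  simp only [Finset.prod_empty, mul_one] at h h2
  rw [h2] at h
  simpa [latentMean] using h

theorem latentMean_const (hθ : θ ∈ admissible G₀ G₁) (c : ℝ) :
    latentMean (n := n) θ (fun _ _ => c) = c := by
  simp only [latentMean, ← Finset.sum_mul, sum_latentProb hθ, one_mul]

theorem latentMean_edge_mul (hθ : θ ∈ admissible G₀ G₁) (e : Edge n) (F : Fin Q → Fin Q → ℝ) :
    latentMean θ (fun z a => (if a e then (1 : ℝ) else 0) * F (z e.1.1) (z e.1.2)) =
      ∑ q, ∑ l, θ.grp q * θ.grp l * (θ.con q l * F q l) := by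
  have h := latentMean_mul_prod (θ := θ) (fun z => F (z e.1.1) (z e.1.2)) 0 {e}
  have h2 := sum_prod_mul_pair hθ.2.1 (ne_of_lt e.2) fun q l => F q l * (θ.con q l - 0)
  simp only [Finset.prod_singleton] at h
  rw [h2] at h
  simpa [mul_comm] using h

theorem latentMean_edge (hθ : θ ∈ admissible G₀ G₁) (e : Edge n) :
    latentMean θ (fun _ a => if a e then (1 : ℝ) else 0) = θ.pi1 := by
  simpa [Param.pi1] using latentMean_edge_mul hθ e fun _ _ => 1

theorem latentMean_edges (hθ : θ ∈ admissible G₀ G₁) :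
    latentMean (n := n) θ (fun _ a => ∑ e, if a e then (1 : ℝ) else 0) =
      Fintype.card (Edge n) * θ.pi1 := by
  rw [latentMean_sum]
  simp [latentMean_edge hθ]

theorem sum_grp_mul_grp (hθ : θ ∈ admissible G₀ G₁) : ∑ q, ∑ l, θ.grp q * θ.grp l = 1 := by
  simp only [← Finset.mul_sum, hθ.2.1, mul_one]

theorem latentMean_centered_sq_le (hθ : θ ∈ admissible G₀ G₁) (e : Edge n) :
    latentMean θ (fun _ a => ((if a e then (1 : ℝ) else 0) - θ.pi1) ^ 2) ≤ 1 / 4 := by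
  have h : ∀ (_ : Fin n → Fin Q) (a : Edge n → Bool),
      ((if a e then (1 : ℝ) else 0) - θ.pi1) ^ 2 =
        (1 - 2 * θ.pi1) * (if a e then (1 : ℝ) else 0) + θ.pi1 ^ 2 := by
    intro _ a; split_ifs <;> ring
  have h' : (fun (_ : Fin n → Fin Q) (a : Edge n → Bool) =>
      ((if a e then (1 : ℝ) else 0) - θ.pi1) ^ 2) = fun _ a =>
        (1 - 2 * θ.pi1) * (if a e then (1 : ℝ) else 0) + θ.pi1 ^ 2 := by
    funext z a; exact h z a
  rw [h', latentMean_add, latentMean_const_mul, latentMean_edge hθ, latentMean_const hθ]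
  nlinarith [sq_nonneg (θ.pi1 - 1 / 2)]

theorem latentMean_centered_mul_eq_zero (hθ : θ ∈ admissible G₀ G₁) {e e' : Edge n}
    (h : ∀ v, (v = e.1.1 ∨ v = e.1.2) → ¬ (v = e'.1.1 ∨ v = e'.1.2)) :
    latentMean θ (fun _ a => ((if a e then (1 : ℝ) else 0) - θ.pi1) *
      ((if a e' then (1 : ℝ) else 0) - θ.pi1)) = 0 := by
  have hne : e ≠ e' := by
    rintro rfl; exact h e.1.1 (Or.inl rfl) (Or.inl rfl)
  have h1 := h e.1.1 (Or.inl rfl)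
  have h2 := h e.1.2 (Or.inr rfl)
  push Not at h1 h2
  have h3 := latentMean_mul_prod (n := n) (θ := θ) (fun _ => 1) θ.pi1 {e, e'}
  have h4 := sum_prod_mul_pair_mul_pair hθ.2.1 (ne_of_lt e.2) (ne_of_lt e'.2) h1.1 h1.2
    h2.1 h2.2 (fun q l => θ.con q l - θ.pi1) (fun q l => θ.con q l - θ.pi1)
  simp only [Finset.prod_pair hne, one_mul] at h3
  rw [h3, h4]
  have h5 : ∑ q, ∑ l, θ.grp q * θ.grp l * (θ.con q l - θ.pi1) = 0 := by
    simp only [mul_sub, Finset.sum_sub_distrib, ← Finset.sum_mul, sum_grp_mul_grp hθ, one_mul]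
    rw [Param.pi1, sub_self]
  rw [h5, zero_mul]

/-- The variance of the number of edges: the covariance of `A_e` and `A_{e'}` vanishes when the
edges are disjoint, and is at most `1 / 4` for the at most `n (n - 1) ^ 2` other pairs. -/
theorem latentMean_centered_sum_sq_le (hθ : θ ∈ admissible G₀ G₁) (hn : 1 ≤ n) :
    latentMean (n := n) θ
      (fun _ a => (∑ e, ((if a e then (1 : ℝ) else 0) - θ.pi1)) ^ 2) ≤ n * (n - 1) ^ 2 / 4 := by
  have h1 : (fun (_ : Fin n → Fin Q) (a : Edge n → Bool) =>
      (∑ e, ((if a e then (1 : ℝ) else 0) - θ.pi1)) ^ 2) = fun _ a =>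
        ∑ e, ∑ e', ((if a e then (1 : ℝ) else 0) - θ.pi1) *
          ((if a e' then (1 : ℝ) else 0) - θ.pi1) := by
    funext _ a; rw [sq, Finset.sum_mul_sum]
  rw [h1, latentMean_sum]
  simp only [latentMean_sum]
  have h2 : ∀ e e' : Edge n, latentMean (n := n) θ (fun _ a =>
      ((if a e then (1 : ℝ) else 0) - θ.pi1) * ((if a e' then (1 : ℝ) else 0) - θ.pi1)) ≤
        ∑ v : Fin n, 1 / 4 * ((if v = e.1.1 ∨ v = e.1.2 then (1 : ℝ) else 0) *
          if v = e'.1.1 ∨ v = e'.1.2 then (1 : ℝ) else 0) := by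
    intro e e'
    have hpos : ∀ v : Fin n, 0 ≤ 1 / 4 * ((if v = e.1.1 ∨ v = e.1.2 then (1 : ℝ) else 0) *
          if v = e'.1.1 ∨ v = e'.1.2 then (1 : ℝ) else 0) := by
      intro v; positivity
    by_cases h : ∀ v, (v = e.1.1 ∨ v = e.1.2) → ¬ (v = e'.1.1 ∨ v = e'.1.2)
    · rw [latentMean_centered_mul_eq_zero hθ h]
      exact Finset.sum_nonneg fun v _ => hpos v
    · push Not at h
      obtain ⟨v, hv, hv'⟩ := h
      refine le_trans ?_ (Finset.single_le_sum (fun v _ => hpos v) (Finset.mem_univ v))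
      rw [if_pos hv, if_pos hv']
      have h3 : latentMean (n := n) θ (fun _ a =>
          ((if a e then (1 : ℝ) else 0) - θ.pi1) * ((if a e' then (1 : ℝ) else 0) - θ.pi1)) ≤
          latentMean (n := n) θ (fun _ a =>
            1 / 2 * ((if a e then (1 : ℝ) else 0) - θ.pi1) ^ 2 +
              1 / 2 * ((if a e' then (1 : ℝ) else 0) - θ.pi1) ^ 2) := by
        refine latentMean_mono hθ fun z a => ?_
        nlinarith [sq_nonneg (((if a e then (1 : ℝ) else 0) - θ.pi1) -
          ((if a e' then (1 : ℝ) else 0) - θ.pi1))]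
      refine h3.trans ?_
      rw [latentMean_add, latentMean_const_mul, latentMean_const_mul]
      have := latentMean_centered_sq_le (n := n) hθ e
      have := latentMean_centered_sq_le (n := n) hθ e'
      linarith
  refine (Finset.sum_le_sum fun e _ => Finset.sum_le_sum fun e' _ => h2 e e').trans ?_
  rw [Finset.sum_congr rfl fun e _ => Finset.sum_comm, Finset.sum_comm]
  have h3 : ∀ v : Fin n, ∑ e : Edge n, ∑ e' : Edge n,
      1 / 4 * ((if v = e.1.1 ∨ v = e.1.2 then (1 : ℝ) else 0) *
          if v = e'.1.1 ∨ v = e'.1.2 then (1 : ℝ) else 0) ≤ 1 / 4 * ((n : ℝ) - 1) ^ 2 := by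
    intro v
    simp only [← Finset.mul_sum, ← Finset.sum_mul]
    rw [Finset.sum_boole]
    have h4 : ((Finset.univ.filter fun e : Edge n => v = e.1.1 ∨ v = e.1.2).card : ℝ) ≤ n - 1 := by
      rw [← Nat.cast_one, ← Nat.cast_sub hn]
      exact_mod_cast card_edge_incident_le v
    have h5 : (0 : ℝ) ≤ n - 1 := by
      have : (1 : ℝ) ≤ n := by exact_mod_cast hn
      linarith
    rw [sq]
    gcongr
  refine (Finset.sum_le_sum fun v _ => h3 v).trans (le_of_eq ?_)
  simp
  ring

/-- The mean of the positive part of the centered number of edges: half of the bound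
`√n (n - 1) / 2` on its standard deviation. -/
theorem latentMean_excess_edges_le (hθ : θ ∈ admissible G₀ G₁) (hn : 2 ≤ n) :
    latentMean (n := n) θ (fun _ a => max 0 (∑ e, ((if a e then (1 : ℝ) else 0) - θ.pi1))) ≤
      √n * (n - 1) / 4 := by
  have hn' : (2 : ℝ) ≤ n := by exact_mod_cast hn
  set s : ℝ := √n * (n - 1) / 2 with hs
  have hs0 : 0 < s := by
    have : 0 < √(n : ℝ) := Real.sqrt_pos.2 (by linarith)
    have : (0 : ℝ) < n - 1 := by linarith
    positivity
  have hs2 : s ^ 2 = n * (n - 1) ^ 2 / 4 := by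
    rw [hs, div_pow, mul_pow, Real.sq_sqrt (by linarith)]; ring
  have h0 : latentMean (n := n) θ (fun _ a => ∑ e, ((if a e then (1 : ℝ) else 0) - θ.pi1)) = 0 := by
    rw [latentMean_sum]
    simp only [sub_eq_add_neg, latentMean_add, latentMean_edge hθ, latentMean_const hθ]
    simp
  -- `max 0 t ≤ t / 2 + |t| / 2`, and `|t| ≤ s / 2 + t ^ 2 / (2 s)`.
  have h1 : ∀ t : ℝ, max 0 t ≤ 1 / 2 * t + (s / 4 + 1 / (4 * s) * t ^ 2) := by
    intro t
    have h2 : s / 4 + 1 / (4 * s) * t ^ 2 - |t| / 2 = (|t| - s) ^ 2 / (4 * s) := by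
      field_simp
      rw [sub_sq, sq_abs]
      ring
    have h3 : 0 ≤ (|t| - s) ^ 2 / (4 * s) := by positivity
    refine max_le ?_ ?_
    · linarith [neg_abs_le t]
    · linarith [le_abs_self t]
  refine (latentMean_mono hθ fun z a => h1 _).trans ?_
  rw [latentMean_add, latentMean_const_mul, latentMean_add, latentMean_const_mul, h0,
    latentMean_const hθ]
  have h2 := mul_le_mul_of_nonneg_left (latentMean_centered_sum_sq_le (n := n) hθ (by omega))
    (show 0 ≤ 1 / (4 * s) by positivity)
  rw [← hs2] at h2
  have h3 : 1 / (4 * s) * s ^ 2 = s / 4 := by field_simp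
  rw [h3] at h2
  calc _ ≤ 1 / 2 * 0 + (s / 4 + s / 4) := by linarith
    _ = _ := by rw [hs]; ring

end Latent

variable {Q d₀ d₁ n : ℕ} {G₀ : DensityFamily d₀} {G₁ : DensityFamily d₁}
  {θ θ' θ₀ : Param Q d₀ d₁}

/-! ### Conditional laws of the observations and `ℓ`-values -/

section Noise

theorem measurable_noiseDens (hθ : θ ∈ admissible G₀ G₁) (δ : Bool) (q l : Fin Q) :
    Measurable (noiseDens G₀ G₁ θ δ q l) := by
  cases δ
  · simpa [noiseDens] using G₀.measurable_dens _ hθ.2.2.2.2.1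
  · simpa [noiseDens] using G₁.measurable_dens _ (hθ.2.2.2.2.2.1 q l)

theorem noiseDens_nonneg (hθ : θ ∈ admissible G₀ G₁) (δ : Bool) (q l : Fin Q) (x : ℝ) :
    0 ≤ noiseDens G₀ G₁ θ δ q l x := by
  cases δ
  · simpa [noiseDens] using G₀.dens_nonneg _ hθ.2.2.2.2.1 x
  · simpa [noiseDens] using G₁.dens_nonneg _ (hθ.2.2.2.2.2.1 q l) x

theorem lintegral_noiseDens (hθ : θ ∈ admissible G₀ G₁) (δ : Bool) (q l : Fin Q) :
    ∫⁻ x, ENNReal.ofReal (noiseDens G₀ G₁ θ δ q l x) = 1 := by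
  cases δ
  · simpa [noiseDens] using G₀.lintegral_dens _ hθ.2.2.2.2.1
  · simpa [noiseDens] using G₁.lintegral_dens _ (hθ.2.2.2.2.2.1 q l)

theorem isProbabilityMeasure_noiseLaw (hθ : θ ∈ admissible G₀ G₁) (δ : Bool) (q l : Fin Q) :
    IsProbabilityMeasure (noiseLaw G₀ G₁ θ δ q l) :=
  ⟨by rw [noiseLaw, withDensity_apply _ MeasurableSet.univ, Measure.restrict_univ,
    lintegral_noiseDens hθ]⟩

theorem integrable_noiseDens (hθ : θ ∈ admissible G₀ G₁) (δ : Bool) (q l : Fin Q) :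
    Integrable (noiseDens G₀ G₁ θ δ q l) := by
  refine ⟨(measurable_noiseDens hθ δ q l).aestronglyMeasurable, ?_⟩
  rw [hasFiniteIntegral_iff_ofReal (ae_of_all _ (noiseDens_nonneg hθ δ q l)),
    lintegral_noiseDens hθ]
  exact ENNReal.one_lt_top

theorem noiseLaw_real (hθ : θ ∈ admissible G₀ G₁) (δ : Bool) (q l : Fin Q) {S : Set ℝ}
    (hS : MeasurableSet S) :
    (noiseLaw G₀ G₁ θ δ q l).real S = ∫ x in S, noiseDens G₀ G₁ θ δ q l x := by
  rw [measureReal_def, noiseLaw, withDensity_apply _ hS,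
    integral_eq_lintegral_of_nonneg_ae (ae_of_all _ (noiseDens_nonneg hθ δ q l))
      (measurable_noiseDens hθ δ q l).aestronglyMeasurable]

/-- A linear inequality between the two densities on `S` passes to the probabilities of `S`; the
coefficients may have any sign. -/
theorem noiseLaw_combination_nonpos (hθ : θ ∈ admissible G₀ G₁) (q l : Fin Q) {S : Set ℝ}
    (hS : MeasurableSet S) (c₀ c₁ : ℝ)
    (h : ∀ x ∈ S, c₀ * noiseDens G₀ G₁ θ false q l x + c₁ * noiseDens G₀ G₁ θ true q l x ≤ 0) :
    c₀ * (noiseLaw G₀ G₁ θ false q l).real S + c₁ * (noiseLaw G₀ G₁ θ true q l).real S ≤ 0 := by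
  rw [noiseLaw_real hθ _ _ _ hS, noiseLaw_real hθ _ _ _ hS, ← integral_const_mul,
    ← integral_const_mul, ← integral_add
      ((integrable_noiseDens hθ false q l).integrableOn.const_mul c₀)
      ((integrable_noiseDens hθ true q l).integrableOn.const_mul c₁)]
  exact setIntegral_nonpos hS h

theorem measurable_lfun (hθ : θ ∈ admissible G₀ G₁) (q l : Fin Q) :
    Measurable fun x => lfun G₀ G₁ x q l θ := by
  have h0 := G₀.measurable_dens _ hθ.2.2.2.2.1
  have h1 := G₁.measurable_dens _ (hθ.2.2.2.2.2.1 q l)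
  unfold lfun
  fun_prop

theorem measurableSet_lfun_le (hθ : θ ∈ admissible G₀ G₁) (q l : Fin Q) (t : ℝ) :
    MeasurableSet {x | lfun G₀ G₁ x q l θ ≤ t} :=
  measurable_lfun hθ q l measurableSet_Iic

theorem null_part_nonneg (hθ : θ ∈ admissible G₀ G₁) (q l : Fin Q) (x : ℝ) :
    0 ≤ (1 - θ.con q l) * G₀.dens θ.nul x :=
  mul_nonneg (by linarith [(hθ.2.2.1 q l).2]) (G₀.dens_nonneg _ hθ.2.2.2.2.1 x)

theorem effect_part_nonneg (hθ : θ ∈ admissible G₀ G₁) (q l : Fin Q) (x : ℝ) :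
    0 ≤ θ.con q l * G₁.dens (θ.eff q l) x :=
  mul_nonneg (hθ.2.2.1 q l).1.le (G₁.dens_nonneg _ (hθ.2.2.2.2.2.1 q l) x)

theorem lfun_mem_Icc (hθ : θ ∈ admissible G₀ G₁) (q l : Fin Q) (x : ℝ) :
    lfun G₀ G₁ x q l θ ∈ Icc (0 : ℝ) 1 := by
  have h0 := null_part_nonneg hθ q l x
  have h1 := effect_part_nonneg hθ q l x
  exact ⟨div_nonneg h0 (add_nonneg h0 h1), div_le_one_of_le₀ (by linarith) (add_nonneg h0 h1)⟩

/-- The defining identity of the `ℓ`-value, valid also where both densities vanish. -/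
theorem lfun_mul (hθ : θ ∈ admissible G₀ G₁) (q l : Fin Q) (x : ℝ) :
    lfun G₀ G₁ x q l θ * ((1 - θ.con q l) * G₀.dens θ.nul x + θ.con q l * G₁.dens (θ.eff q l) x) =
      (1 - θ.con q l) * G₀.dens θ.nul x := by
  have h0 := null_part_nonneg hθ q l x
  have h1 := effect_part_nonneg hθ q l x
  rcases eq_or_ne ((1 - θ.con q l) * G₀.dens θ.nul x + θ.con q l * G₁.dens (θ.eff q l) x) 0
    with h | h
  · rw [h, mul_zero]; linarith
  · exact div_mul_cancel₀ _ h

theorem qfun_nonneg (δ : Bool) (t : ℝ) (q l : Fin Q) : 0 ≤ qfun G₀ G₁ δ t q l θ' θ :=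
  measureReal_nonneg

theorem qfun_le_one (hθ' : θ' ∈ admissible G₀ G₁) (δ : Bool) (t : ℝ) (q l : Fin Q) :
    qfun G₀ G₁ δ t q l θ' θ ≤ 1 := by
  have := isProbabilityMeasure_noiseLaw hθ' δ q l
  exact measureReal_le_one

theorem abs_qfun_sub_le_one (hθ' : θ' ∈ admissible G₀ G₁) (hθ₀ : θ₀ ∈ admissible G₀ G₁)
    (δ δ' : Bool) (t t' : ℝ) (q l : Fin Q) {θ₁ : Param Q d₀ d₁} :
    |qfun G₀ G₁ δ t q l θ' θ - qfun G₀ G₁ δ' t' q l θ₀ θ₁| ≤ 1 := by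
  rw [abs_le]
  constructor <;>
  linarith [qfun_nonneg (G₀ := G₀) (G₁ := G₁) (θ' := θ') (θ := θ) δ t q l,
    qfun_nonneg (G₀ := G₀) (G₁ := G₁) (θ' := θ₀) (θ := θ₁) δ' t' q l,
    qfun_le_one (θ := θ) hθ' δ t q l, qfun_le_one (θ := θ₁) hθ₀ δ' t' q l]

theorem qfun_mono (hθ' : θ' ∈ admissible G₀ G₁) (δ : Bool) (q l : Fin Q) :
    Monotone fun t => qfun G₀ G₁ δ t q l θ' θ := by
  have := isProbabilityMeasure_noiseLaw hθ' δ q l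
  exact fun s t hst => measureReal_mono fun x hx => le_trans hx hst

end Noise

/-! ### Monotonicity of the marginal false discovery rate -/

section Mfdr

/-- The numerator of `mfdr θ θ`: the probability that an edge is absent and that its `ℓ`-value
is at most `t`. -/
noncomputable def falseMass (G₀ : DensityFamily d₀) (G₁ : DensityFamily d₁) (θ : Param Q d₀ d₁)
    (t : ℝ) : ℝ :=
  ∑ q, ∑ l, θ.grp q * θ.grp l * ((1 - θ.con q l) * qfun G₀ G₁ false t q l θ θ)

/-- The denominator of `mfdr θ θ`: the probability that the `ℓ`-value of an edge is at most `t`. -/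
noncomputable def totalMass (G₀ : DensityFamily d₀) (G₁ : DensityFamily d₁) (θ : Param Q d₀ d₁)
    (t : ℝ) : ℝ :=
  ∑ q, ∑ l, θ.grp q * θ.grp l *
    ((1 - θ.con q l) * qfun G₀ G₁ false t q l θ θ + θ.con q l * qfun G₀ G₁ true t q l θ θ)

theorem mfdr_self (t : ℝ) :
    mfdr G₀ G₁ θ θ t = falseMass G₀ G₁ θ t / totalMass G₀ G₁ θ t := rfl

theorem grp_mul_nonneg (hθ : θ ∈ admissible G₀ G₁) (q l : Fin Q) : 0 ≤ θ.grp q * θ.grp l :=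
  mul_nonneg (hθ.1 q).le (hθ.1 l).le

theorem falseMass_nonneg (hθ : θ ∈ admissible G₀ G₁) (t : ℝ) : 0 ≤ falseMass G₀ G₁ θ t :=
  Finset.sum_nonneg fun q _ => Finset.sum_nonneg fun l _ => mul_nonneg (grp_mul_nonneg hθ q l)
    (mul_nonneg (by linarith [(hθ.2.2.1 q l).2]) (qfun_nonneg _ _ _ _))

theorem totalMass_term_nonneg (hθ : θ ∈ admissible G₀ G₁) (t : ℝ) (q l : Fin Q) :
    0 ≤ θ.grp q * θ.grp l * ((1 - θ.con q l) * qfun G₀ G₁ false t q l θ θ +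
      θ.con q l * qfun G₀ G₁ true t q l θ θ) :=
  mul_nonneg (grp_mul_nonneg hθ q l) (add_nonneg
    (mul_nonneg (by linarith [(hθ.2.2.1 q l).2]) (qfun_nonneg _ _ _ _))
    (mul_nonneg (hθ.2.2.1 q l).1.le (qfun_nonneg _ _ _ _)))

theorem totalMass_nonneg (hθ : θ ∈ admissible G₀ G₁) (t : ℝ) : 0 ≤ totalMass G₀ G₁ θ t :=
  Finset.sum_nonneg fun q _ => Finset.sum_nonneg fun l _ => totalMass_term_nonneg hθ t q l

theorem falseMass_le_totalMass (hθ : θ ∈ admissible G₀ G₁) (t : ℝ) :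
    falseMass G₀ G₁ θ t ≤ totalMass G₀ G₁ θ t :=
  Finset.sum_le_sum fun q _ => Finset.sum_le_sum fun l _ =>
    mul_le_mul_of_nonneg_left (le_add_of_nonneg_right
      (mul_nonneg (hθ.2.2.1 q l).1.le (qfun_nonneg _ _ _ _))) (grp_mul_nonneg hθ q l)

theorem mfdr_nonneg (hθ : θ ∈ admissible G₀ G₁) (t : ℝ) : 0 ≤ mfdr G₀ G₁ θ θ t :=
  div_nonneg (falseMass_nonneg hθ t) (totalMass_nonneg hθ t)

theorem totalMass_mono (hθ : θ ∈ admissible G₀ G₁) : Monotone (totalMass G₀ G₁ θ) := by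
  intro s t hst
  refine Finset.sum_le_sum fun q _ => Finset.sum_le_sum fun l _ =>
    mul_le_mul_of_nonneg_left (add_le_add
      (mul_le_mul_of_nonneg_left (qfun_mono hθ false q l hst) ?_)
      (mul_le_mul_of_nonneg_left (qfun_mono hθ true q l hst) (hθ.2.2.1 q l).1.le))
      (grp_mul_nonneg hθ q l)
  linarith [(hθ.2.2.1 q l).2]

theorem falseMass_le_mul_totalMass (hθ : θ ∈ admissible G₀ G₁) (t : ℝ) :
    falseMass G₀ G₁ θ t ≤ t * totalMass G₀ G₁ θ t := by
  simp only [falseMass, totalMass, Finset.mul_sum]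
  refine Finset.sum_le_sum fun q _ => Finset.sum_le_sum fun l _ => ?_
  have h := noiseLaw_combination_nonpos hθ q l (measurableSet_lfun_le hθ q l t)
    ((1 - t) * (1 - θ.con q l)) (-(t * θ.con q l)) (fun x hx => by
      have h1 := lfun_mul hθ q l x
      have h2 := add_nonneg (null_part_nonneg hθ q l x) (effect_part_nonneg hθ q l x)
      have h3 := mul_le_mul_of_nonneg_right (show lfun G₀ G₁ x q l θ ≤ t from hx) h2
      simp only [noiseDens, if_true, Bool.false_eq_true, if_false]
      linarith)
  have h' : (1 - θ.con q l) * qfun G₀ G₁ false t q l θ θ ≤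
      t * ((1 - θ.con q l) * qfun G₀ G₁ false t q l θ θ +
        θ.con q l * qfun G₀ G₁ true t q l θ θ) := by
    unfold qfun; linarith
  have := mul_le_mul_of_nonneg_left h' (grp_mul_nonneg hθ q l)
  linarith

theorem mul_totalMass_sub_le (hθ : θ ∈ admissible G₀ G₁) {t t' : ℝ} (h : t ≤ t') :
    t * (totalMass G₀ G₁ θ t' - totalMass G₀ G₁ θ t) ≤
      falseMass G₀ G₁ θ t' - falseMass G₀ G₁ θ t := by
  simp only [falseMass, totalMass, ← Finset.sum_sub_distrib, Finset.mul_sum]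
  refine Finset.sum_le_sum fun q _ => Finset.sum_le_sum fun l _ => ?_
  have hS := measurableSet_lfun_le hθ q l t
  have hS' := measurableSet_lfun_le hθ q l t'
  have hsub : {x | lfun G₀ G₁ x q l θ ≤ t} ⊆ {x | lfun G₀ G₁ x q l θ ≤ t'} :=
    fun x hx => le_trans hx h
  have hd : ∀ δ, (noiseLaw G₀ G₁ θ δ q l).real
      ({x | lfun G₀ G₁ x q l θ ≤ t'} \ {x | lfun G₀ G₁ x q l θ ≤ t}) =
        qfun G₀ G₁ δ t' q l θ θ - qfun G₀ G₁ δ t q l θ θ := by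
    intro δ
    have := isProbabilityMeasure_noiseLaw hθ δ q l
    exact measureReal_sdiff hsub hS
  have h1 := noiseLaw_combination_nonpos hθ q l (hS'.diff hS)
    (-((1 - t) * (1 - θ.con q l))) (t * θ.con q l) (fun x hx => by
      have h1 := lfun_mul hθ q l x
      have h2 := add_nonneg (null_part_nonneg hθ q l x) (effect_part_nonneg hθ q l x)
      have h3 := mul_le_mul_of_nonneg_right (le_of_lt (not_le.1 hx.2)) h2
      simp only [noiseDens, if_true, Bool.false_eq_true, if_false]
      linarith)
  rw [hd, hd] at h1
  have h2 : t * (((1 - θ.con q l) * qfun G₀ G₁ false t' q l θ θ +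
        θ.con q l * qfun G₀ G₁ true t' q l θ θ) -
      ((1 - θ.con q l) * qfun G₀ G₁ false t q l θ θ +
        θ.con q l * qfun G₀ G₁ true t q l θ θ)) ≤
      (1 - θ.con q l) * qfun G₀ G₁ false t' q l θ θ -
        (1 - θ.con q l) * qfun G₀ G₁ false t q l θ θ := by
    linarith
  have := mul_le_mul_of_nonneg_left h2 (grp_mul_nonneg hθ q l)
  linarith

/-- Under the true parameter, `mfdr θ θ t` is the mean of the `ℓ`-values that are at most `t`,
hence it is nondecreasing in `t`. -/
theorem mfdr_mono (hθ : θ ∈ admissible G₀ G₁) : Monotone (mfdr G₀ G₁ θ θ) := by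
  intro t t' h
  rcases (totalMass_nonneg hθ t).eq_or_lt with h0 | h0
  · rw [mfdr_self t, ← h0, div_zero]
    exact mfdr_nonneg hθ t'
  · rw [mfdr_self, mfdr_self, div_le_div_iff₀ h0 (h0.trans_le (totalMass_mono hθ h))]
    have h1 := falseMass_le_mul_totalMass hθ t
    have h2 := mul_totalMass_sub_le hθ h
    have h3 := sub_nonneg.2 (totalMass_mono hθ h)
    nlinarith [mul_le_mul_of_nonneg_right h2 h0.le, mul_le_mul_of_nonneg_right h1 h3]

theorem mfdr_relabel (σ : Equiv.Perm (Fin Q)) (t : ℝ) :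
    mfdr G₀ G₁ (θ.relabel σ) (θ.relabel σ) t = mfdr G₀ G₁ θ θ t := by
  have h1 : falseMass G₀ G₁ (θ.relabel σ) t = falseMass G₀ G₁ θ t := by
    unfold falseMass
    symm
    rw [← Equiv.sum_comp σ]
    refine Finset.sum_congr rfl fun q _ => ?_
    rw [← Equiv.sum_comp σ]
    rfl
  have h2 : totalMass G₀ G₁ (θ.relabel σ) t = totalMass G₀ G₁ θ t := by
    unfold totalMass
    symm
    rw [← Equiv.sum_comp σ]
    refine Finset.sum_congr rfl fun q _ => ?_
    rw [← Equiv.sum_comp σ]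
    rfl
  rw [mfdr_self, mfdr_self, h1, h2]

end Mfdr

/-! ### Stability of the marginal false discovery rate in the parameter -/

section Perturbation

theorem abs_grp_sub_le (q : Fin Q) : |θ.grp q - θ₀.grp q| ≤ ‖θ - θ₀‖ :=
  (norm_le_pi_norm (θ - θ₀).1 q).trans (norm_fst_le _)

theorem abs_con_sub_le (q l : Fin Q) : |θ.con q l - θ₀.con q l| ≤ ‖θ - θ₀‖ :=
  (norm_le_pi_norm ((θ - θ₀).2.1 q) l).trans <| (norm_le_pi_norm (θ - θ₀).2.1 q).trans <|
    (norm_fst_le (θ - θ₀).2).trans (norm_snd_le _)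

theorem grp_le_one (hθ : θ ∈ admissible G₀ G₁) (q : Fin Q) : θ.grp q ≤ 1 := by
  rw [← hθ.2.1]
  exact Finset.single_le_sum (fun q _ => (hθ.1 q).le) (Finset.mem_univ q)

theorem one_le_card_groups (hθ : θ ∈ admissible G₀ G₁) : 1 ≤ Q := by
  rcases Nat.eq_zero_or_pos Q with rfl | h
  · have := hθ.2.1
    simp at this
  · exact h

/-- Stability of the averages `∑ π_q π_l c_{q,l}` for `c` with values in `[0, 1]`. -/
theorem abs_sum_grp_mul_sub_le (hθ : θ ∈ admissible G₀ G₁) (hθ₀ : θ₀ ∈ admissible G₀ G₁)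
    {ε W : ℝ} (hε : ‖θ - θ₀‖ ≤ ε) {c c' : Fin Q → Fin Q → ℝ} (hc0 : ∀ q l, 0 ≤ c q l)
    (hc1 : ∀ q l, c q l ≤ 1) (hcc : ∀ q l, |c q l - c' q l| ≤ W + ε) :
    |∑ q, ∑ l, θ.grp q * θ.grp l * c q l - ∑ q, ∑ l, θ₀.grp q * θ₀.grp l * c' q l| ≤
      W + 3 * (Q : ℝ) ^ 2 * ε := by
  have hε0 : 0 ≤ ε := (norm_nonneg _).trans hε
  have h1 : ∀ q l, |θ.grp q * θ.grp l * c q l - θ₀.grp q * θ₀.grp l * c' q l| ≤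
      2 * ε + θ₀.grp q * θ₀.grp l * (W + ε) := by
    intro q l
    have e : θ.grp q * θ.grp l * c q l - θ₀.grp q * θ₀.grp l * c' q l =
        (θ.grp q - θ₀.grp q) * (θ.grp l * c q l) + θ₀.grp q * c q l * (θ.grp l - θ₀.grp l) +
          θ₀.grp q * θ₀.grp l * (c q l - c' q l) := by ring
    rw [e]
    refine (abs_add_three _ _ _).trans ?_
    rw [abs_mul, abs_mul (θ₀.grp q * c q l), abs_mul (θ₀.grp q * θ₀.grp l),
      abs_of_nonneg (grp_mul_nonneg hθ₀ q l),
      abs_of_nonneg (mul_nonneg (hθ.1 l).le (hc0 q l)),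
      abs_of_nonneg (mul_nonneg (hθ₀.1 q).le (hc0 q l))]
    have h2 := (abs_grp_sub_le (θ := θ) (θ₀ := θ₀) q).trans hε
    have h3 := (abs_grp_sub_le (θ := θ) (θ₀ := θ₀) l).trans hε
    have h4 : θ.grp l * c q l ≤ 1 := mul_le_one₀ (grp_le_one hθ l) (hc0 q l) (hc1 q l)
    have h5 : θ₀.grp q * c q l ≤ 1 := mul_le_one₀ (grp_le_one hθ₀ q) (hc0 q l) (hc1 q l)
    have h6 := mul_le_mul h2 h4 (mul_nonneg (hθ.1 l).le (hc0 q l)) hε0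
    have h7 := mul_le_mul h5 h3 (abs_nonneg _) zero_le_one
    have h8 := mul_le_mul_of_nonneg_left (hcc q l) (grp_mul_nonneg hθ₀ q l)
    linarith
  rw [← Finset.sum_sub_distrib]
  simp only [← Finset.sum_sub_distrib]
  calc _ ≤ ∑ q, ∑ l, (2 * ε + θ₀.grp q * θ₀.grp l * (W + ε)) :=
        (Finset.abs_sum_le_sum_abs _ _).trans <| Finset.sum_le_sum fun q _ =>
          (Finset.abs_sum_le_sum_abs _ _).trans <| Finset.sum_le_sum fun l _ => h1 q l
    _ = 2 * (Q : ℝ) ^ 2 * ε + (W + ε) := by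
        simp only [Finset.sum_add_distrib, ← Finset.sum_mul, sum_grp_mul_grp hθ₀]
        simp only [Finset.sum_const, Finset.card_univ, Fintype.card_fin, nsmul_eq_mul]
        ring
    _ ≤ _ := by
        have hQ : (1 : ℝ) ≤ Q := by exact_mod_cast one_le_card_groups hθ₀
        have : (1 : ℝ) ≤ (Q : ℝ) ^ 2 := one_le_pow₀ hQ
        nlinarith

theorem abs_falseMass_sub_le (hθ : θ ∈ admissible G₀ G₁) (hθ₀ : θ₀ ∈ admissible G₀ G₁)
    {ε W t : ℝ} (hε : ‖θ - θ₀‖ ≤ ε)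
    (hW : ∀ δ q l, |qfun G₀ G₁ δ t q l θ θ - qfun G₀ G₁ δ t q l θ₀ θ₀| ≤ W) :
    |falseMass G₀ G₁ θ t - falseMass G₀ G₁ θ₀ t| ≤ W + 3 * (Q : ℝ) ^ 2 * ε := by
  refine abs_sum_grp_mul_sub_le hθ hθ₀ hε (fun q l => ?_) (fun q l => ?_) fun q l => ?_
  · exact mul_nonneg (by linarith [(hθ.2.2.1 q l).2]) (qfun_nonneg _ _ _ _)
  · exact mul_le_one₀ (by linarith [(hθ.2.2.1 q l).1]) (qfun_nonneg _ _ _ _)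
      (qfun_le_one hθ _ _ _ _)
  · have e : (1 - θ.con q l) * qfun G₀ G₁ false t q l θ θ -
        (1 - θ₀.con q l) * qfun G₀ G₁ false t q l θ₀ θ₀ =
        (1 - θ₀.con q l) * (qfun G₀ G₁ false t q l θ θ - qfun G₀ G₁ false t q l θ₀ θ₀) +
          -((θ.con q l - θ₀.con q l) * qfun G₀ G₁ false t q l θ θ) := by ring
    rw [e]
    refine (abs_add_le _ _).trans ?_
    rw [abs_neg, abs_mul, abs_mul, abs_of_nonneg (qfun_nonneg _ _ _ _),
      abs_of_nonneg (show 0 ≤ 1 - θ₀.con q l by linarith [(hθ₀.2.2.1 q l).2])]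
    have h1 := mul_le_mul (show 1 - θ₀.con q l ≤ 1 by linarith [(hθ₀.2.2.1 q l).1])
      (hW false q l) (abs_nonneg _) zero_le_one
    have h2 := mul_le_mul ((abs_con_sub_le (θ := θ) (θ₀ := θ₀) q l).trans hε)
      (qfun_le_one (θ := θ) hθ false t q l) (qfun_nonneg _ _ _ _) ((norm_nonneg _).trans hε)
    linarith

theorem abs_totalMass_sub_le (hθ : θ ∈ admissible G₀ G₁) (hθ₀ : θ₀ ∈ admissible G₀ G₁)
    {ε W t : ℝ} (hε : ‖θ - θ₀‖ ≤ ε)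
    (hW : ∀ δ q l, |qfun G₀ G₁ δ t q l θ θ - qfun G₀ G₁ δ t q l θ₀ θ₀| ≤ W) :
    |totalMass G₀ G₁ θ t - totalMass G₀ G₁ θ₀ t| ≤ W + 3 * (Q : ℝ) ^ 2 * ε := by
  refine abs_sum_grp_mul_sub_le hθ hθ₀ hε (fun q l => ?_) (fun q l => ?_) fun q l => ?_
  · exact add_nonneg
      (mul_nonneg (by linarith [(hθ.2.2.1 q l).2]) (qfun_nonneg _ _ _ _))
      (mul_nonneg (hθ.2.2.1 q l).1.le (qfun_nonneg _ _ _ _))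
  · have h1 := mul_le_mul_of_nonneg_left (qfun_le_one (θ := θ) hθ false t q l)
      (show 0 ≤ 1 - θ.con q l by linarith [(hθ.2.2.1 q l).2])
    have h2 := mul_le_mul_of_nonneg_left (qfun_le_one (θ := θ) hθ true t q l)
      (hθ.2.2.1 q l).1.le
    linarith
  · have e : (1 - θ.con q l) * qfun G₀ G₁ false t q l θ θ +
          θ.con q l * qfun G₀ G₁ true t q l θ θ -
        ((1 - θ₀.con q l) * qfun G₀ G₁ false t q l θ₀ θ₀ +
          θ₀.con q l * qfun G₀ G₁ true t q l θ₀ θ₀) =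
        (1 - θ₀.con q l) * (qfun G₀ G₁ false t q l θ θ - qfun G₀ G₁ false t q l θ₀ θ₀) +
        θ₀.con q l * (qfun G₀ G₁ true t q l θ θ - qfun G₀ G₁ true t q l θ₀ θ₀) +
          (θ.con q l - θ₀.con q l) *
            (qfun G₀ G₁ true t q l θ θ - qfun G₀ G₁ false t q l θ θ) := by ring
    rw [e]
    refine (abs_add_three _ _ _).trans ?_
    rw [abs_mul, abs_mul, abs_mul (θ.con q l - θ₀.con q l), abs_of_nonneg (hθ₀.2.2.1 q l).1.le,
      abs_of_nonneg (show 0 ≤ 1 - θ₀.con q l by linarith [(hθ₀.2.2.1 q l).2])]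
    have h1 := mul_le_mul_of_nonneg_left (hW false q l)
      (show 0 ≤ 1 - θ₀.con q l by linarith [(hθ₀.2.2.1 q l).2])
    have h2 := mul_le_mul_of_nonneg_left (hW true q l) (hθ₀.2.2.1 q l).1.le
    have h3 := mul_le_mul ((abs_con_sub_le (θ := θ) (θ₀ := θ₀) q l).trans hε)
      (abs_qfun_sub_le_one (θ := θ) (θ₁ := θ) hθ hθ true false t t q l) (abs_nonneg _)
      ((norm_nonneg _).trans hε)
    linarith

/-- Stability of the ratio `falseMass / totalMass`, when the denominator at `θ₀` is at least `κ`
and the numerator and the denominator move by at most `D ≤ κ / 2`. -/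
theorem mfdr_le_add (hθ₀ : θ₀ ∈ admissible G₀ G₁) {κ D t : ℝ}
    (hκ : 0 < κ) (hκt : κ ≤ totalMass G₀ G₁ θ₀ t) (hD : D ≤ κ / 2)
    (h1 : |falseMass G₀ G₁ θ t - falseMass G₀ G₁ θ₀ t| ≤ D)
    (h2 : |totalMass G₀ G₁ θ t - totalMass G₀ G₁ θ₀ t| ≤ D) :
    mfdr G₀ G₁ θ θ t ≤ mfdr G₀ G₁ θ₀ θ₀ t + 4 * κ⁻¹ * D := by
  rw [mfdr_self, mfdr_self]
  have h3 := falseMass_le_totalMass hθ₀ t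
  have h4 := falseMass_nonneg hθ₀ t
  generalize falseMass G₀ G₁ θ t = N' at *
  generalize totalMass G₀ G₁ θ t = D' at *
  generalize falseMass G₀ G₁ θ₀ t = N at *
  generalize totalMass G₀ G₁ θ₀ t = T at *
  have hT : 0 < T := hκ.trans_le hκt
  rw [abs_le] at h1 h2
  have hD' : κ / 2 ≤ D' := by linarith
  have hD'0 : 0 < D' := by linarith
  have hD0 : 0 ≤ D := by linarith
  have hr : N / T ≤ 1 := div_le_one_of_le₀ h3 hT.le
  have hr0 : 0 ≤ N / T := div_nonneg h4 hT.le
  rw [div_le_iff₀ hD'0]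
  have e : N = N / T * T := by field_simp
  have h5 : 2 * D ≤ 4 * κ⁻¹ * D * D' := by
    calc 2 * D = 4 * κ⁻¹ * D * (κ / 2) := by field_simp; ring
      _ ≤ _ := by gcongr
  nlinarith [mul_le_mul_of_nonneg_left h2.1 hr0]

end Perturbation

variable {Θ : Set (Param Q d₀ d₁)} {t₁ t₂ : Fin Q → Fin Q → Param Q d₀ d₁ → ℝ}

/-! ### The threshold `T_{θ₀}` -/

section Threshold

theorem bddAbove_thr_set (y : ℝ) : BddAbove {t | t ∈ Icc (0 : ℝ) 1 ∧ mfdr G₀ G₁ θ₀ θ₀ t ≤ y} :=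
  ⟨1, fun _ ht => ht.1.2⟩

theorem thr_mem_Icc (y : ℝ) : thr G₀ G₁ θ₀ y ∈ Icc (0 : ℝ) 1 :=
  ⟨Real.sSup_nonneg fun _ ht => ht.1.1, Real.sSup_le (fun _ ht => ht.1.2) zero_le_one⟩

theorem le_thr {t y : ℝ} (ht : t ∈ Icc (0 : ℝ) 1) (h : mfdr G₀ G₁ θ₀ θ₀ t ≤ y) :
    t ≤ thr G₀ G₁ θ₀ y :=
  le_csSup (bddAbove_thr_set y) ⟨ht, h⟩

/-- To the right of `min t_{1,q,l}` some group pair has a positive rejection probability. -/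
theorem totalMass_pos (hΘ : IsParamSpace G₀ G₁ Θ) (hreg : Regularity G₀ G₁ Θ t₁ t₂)
    (hθ₀ : θ₀ ∈ Θ) {t : ℝ} (ht : (⨅ p : Fin Q × Fin Q, t₁ p.1 p.2 θ₀) < t) (ht1 : t ≤ 1) :
    0 < totalMass G₀ G₁ θ₀ t := by
  have hadm := hΘ.subset_admissible hθ₀
  have : Nonempty (Fin Q × Fin Q) := by
    have : NeZero Q := ⟨by have := one_le_card_groups hadm; omega⟩
    exact ⟨(0, 0)⟩
  obtain ⟨⟨q, l⟩, hql⟩ := exists_eq_ciInf_of_finite (f := fun p : Fin Q × Fin Q => t₁ p.1 p.2 θ₀)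
  rw [← hql] at ht
  simp only at ht
  have hb := hreg.bounds q l θ₀ hθ₀
  have hq : 0 < qfun G₀ G₁ true t q l θ₀ θ₀ := by
    rcases le_total t (t₂ q l θ₀) with h | h
    · have h1 := hreg.increasing true q l θ₀ hθ₀ θ₀ hθ₀ (left_mem_Icc.2 hb.2.1.le) ⟨ht.le, h⟩ ht
      exact (qfun_nonneg _ _ _ _).trans_lt h1
    · rw [hreg.eq_one true q l θ₀ hθ₀ θ₀ hθ₀ t ⟨h, ht1⟩]
      exact one_pos
  have hpos : 0 < θ₀.grp q * θ₀.grp l * ((1 - θ₀.con q l) * qfun G₀ G₁ false t q l θ₀ θ₀ +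
      θ₀.con q l * qfun G₀ G₁ true t q l θ₀ θ₀) :=
    mul_pos (mul_pos (hadm.1 q) (hadm.1 l)) (add_pos_of_nonneg_of_pos
      (mul_nonneg (by linarith [(hadm.2.2.1 q l).2]) (qfun_nonneg _ _ _ _))
      (mul_pos (hadm.2.2.1 q l).1 hq))
  refine hpos.trans_le ?_
  refine le_trans ?_ (Finset.single_le_sum (fun q _ => Finset.sum_nonneg fun l _ =>
    totalMass_term_nonneg hadm t q l) (Finset.mem_univ q))
  exact Finset.single_le_sum (fun l _ => totalMass_term_nonneg hadm t q l) (Finset.mem_univ l)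

/-- Above the critical level, the supremum that defines `T_{θ₀}(y)` is attained, at a point with
positive rejection probability, and `T_{θ₀}` is monotone. -/
theorem thr_spec (hΘ : IsParamSpace G₀ G₁ Θ) (hreg : Regularity G₀ G₁ Θ t₁ t₂)
    (hθ₀ : θ₀ ∈ Θ) {y : ℝ} (hy : alphaStar G₀ G₁ t₁ θ₀ < y) :
    0 < totalMass G₀ G₁ θ₀ (thr G₀ G₁ θ₀ y) ∧ mfdr G₀ G₁ θ₀ θ₀ (thr G₀ G₁ θ₀ y) ≤ y ∧
      ∀ y', y ≤ y' → thr G₀ G₁ θ₀ y ≤ thr G₀ G₁ θ₀ y' := by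
  have hadm := hΘ.subset_admissible hθ₀
  have : Nonempty (Fin Q × Fin Q) := by
    have : NeZero Q := ⟨by have := one_le_card_groups hadm; omega⟩
    exact ⟨(0, 0)⟩
  have hmono := mfdr_mono hadm
  set τ := ⨅ p : Fin Q × Fin Q, t₁ p.1 p.2 θ₀ with hτ
  have hτ0 : 0 ≤ τ := Real.iInf_nonneg fun p => (hreg.bounds p.1 p.2 θ₀ hθ₀).1
  have hτ1 : τ < 1 := by
    obtain ⟨p, hp⟩ := exists_eq_ciInf_of_finite (f := fun p : Fin Q × Fin Q => t₁ p.1 p.2 θ₀)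
    have hb := hreg.bounds p.1 p.2 θ₀ hθ₀
    rw [hτ, ← hp]
    linarith [hb.2.1, hb.2.2]
  -- the level `y` is reached to the right of `τ`
  obtain ⟨s, hs, hsy⟩ : ∃ s ∈ Ioo τ 1, mfdr G₀ G₁ θ₀ θ₀ s < y := by
    have h1 := (hmono.tendsto_rightLim τ).eventually (gt_mem_nhds hy)
    have h2 : ∀ᶠ s in 𝓝[>] τ, s ∈ Ioo τ 1 := Ioo_mem_nhdsGT hτ1
    obtain ⟨s, hs⟩ := (h2.and h1).exists
    exact ⟨s, hs.1, hs.2⟩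
  have hsS : s ∈ {t | t ∈ Icc (0 : ℝ) 1 ∧ mfdr G₀ G₁ θ₀ θ₀ t ≤ y} :=
    ⟨⟨hτ0.trans hs.1.le, hs.2.le⟩, hsy.le⟩
  have hT := thr_mem_Icc (G₀ := G₀) (G₁ := G₁) (θ₀ := θ₀) y
  have hsT : s ≤ thr G₀ G₁ θ₀ y := le_thr hsS.1 hsS.2
  have hpos := totalMass_pos hΘ hreg hθ₀ (hs.1.trans_le hsT) hT.2
  refine ⟨hpos, ?_, fun y' hyy' => csSup_le_csSup (bddAbove_thr_set y') ⟨s, hsS⟩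
    fun t ht => ⟨ht.1, ht.2.trans hyy'⟩⟩
  have hT0 : 0 < thr G₀ G₁ θ₀ y := (hτ0.trans_lt hs.1).trans_le hsT
  have hcont : ContinuousWithinAt (mfdr G₀ G₁ θ₀ θ₀) (Icc 0 1) (thr G₀ G₁ θ₀ y) := by
    have hq : ∀ δ q l, ContinuousOn (fun t => qfun G₀ G₁ δ t q l θ₀ θ₀) (Icc 0 1) :=
      fun δ q l => hreg.continuousOn_t δ q l θ₀ hθ₀ θ₀ hθ₀
    have hN : ContinuousOn (falseMass G₀ G₁ θ₀) (Icc 0 1) :=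
      continuousOn_finsetSum _ fun q _ => continuousOn_finsetSum _ fun l _ =>
        continuousOn_const.mul (continuousOn_const.mul (hq false q l))
    have hD : ContinuousOn (totalMass G₀ G₁ θ₀) (Icc 0 1) :=
      continuousOn_finsetSum _ fun q _ => continuousOn_finsetSum _ fun l _ =>
        continuousOn_const.mul ((continuousOn_const.mul (hq false q l)).add
          (continuousOn_const.mul (hq true q l)))
    exact (hN _ hT).div (hD _ hT) hpos.ne'
  -- the levels just below the supremum are at most `y`; pass to the limit from the left
  have hlim := (hcont.mono (show Ico 0 (thr G₀ G₁ θ₀ y) ⊆ Icc 0 1 from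
    fun t ht => ⟨ht.1, ht.2.le.trans hT.2⟩)).tendsto
  rw [nhdsWithin_Ico_eq_nhdsLT hT0] at hlim
  refine le_of_tendsto hlim ?_
  filter_upwards [self_mem_nhdsWithin] with t ht
  obtain ⟨r, hr, htr⟩ := exists_lt_of_lt_csSup ⟨s, hsS⟩ (show t < sSup _ from ht)
  exact (hmono htr.le).trans hr.2

end Threshold

/-! ### Moduli of continuity -/

section Moduli

variable {𝒦 : Set ℝ}

theorem le_modT {α u y : ℝ} (hy : y ∈ 𝒦) (hu : |y - α| ≤ u) :
    |thr G₀ G₁ θ₀ y - thr G₀ G₁ θ₀ α| ≤ modT G₀ G₁ θ₀ α 𝒦 u := by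
  refine le_csSup ⟨1, ?_⟩ ⟨y, hy, hu, rfl⟩
  rintro r ⟨y, -, -, rfl⟩
  have h1 := thr_mem_Icc (G₀ := G₀) (G₁ := G₁) (θ₀ := θ₀) y
  have h2 := thr_mem_Icc (G₀ := G₀) (G₁ := G₁) (θ₀ := θ₀) α
  rw [abs_le]
  constructor <;> linarith [h1.1, h1.2, h2.1, h2.2]

theorem le_modq1 (hθ₀ : θ₀ ∈ admissible G₀ G₁) {α u t : ℝ} (ht : t ∈ thr G₀ G₁ θ₀ '' 𝒦)
    (hu : |t - thr G₀ G₁ θ₀ α| ≤ u) (q l : Fin Q) :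
    |qfun G₀ G₁ true t q l θ₀ θ₀ - qfun G₀ G₁ true (thr G₀ G₁ θ₀ α) q l θ₀ θ₀| ≤
      modq1 G₀ G₁ θ₀ α 𝒦 u := by
  refine le_csSup ⟨1, ?_⟩ ⟨q, l, t, ht, hu, rfl⟩
  rintro r ⟨q, l, t, -, -, rfl⟩
  exact abs_qfun_sub_le_one hθ₀ hθ₀ _ _ _ _ _ _

theorem modq1_nonneg (α u : ℝ) : 0 ≤ modq1 G₀ G₁ θ₀ α 𝒦 u := by
  refine Real.sSup_nonneg ?_
  rintro r ⟨q, l, t, -, -, rfl⟩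
  exact abs_nonneg _

theorem modq_nonneg (u : ℝ) : 0 ≤ modq G₀ G₁ Θ θ₀ 𝒦 u := by
  refine Real.sSup_nonneg ?_
  rintro r ⟨q, l, t, -, δ, θ, -, θ', -, -, -, rfl⟩
  exact abs_nonneg _

theorem le_modq (hΘ : IsParamSpace G₀ G₁ Θ) (hθ₀ : θ₀ ∈ Θ) {u t : ℝ}
    (ht : t ∈ thr G₀ G₁ θ₀ '' 𝒦) {θ θ' : Param Q d₀ d₁} (hθ : θ ∈ Θ) (hθ' : θ' ∈ Θ)
    (hu : ‖θ - θ₀‖ ≤ u) (hu' : ‖θ' - θ₀‖ ≤ u) (δ : Bool) (q l : Fin Q) :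
    |qfun G₀ G₁ δ t q l θ' θ - qfun G₀ G₁ δ t q l θ₀ θ₀| ≤ modq G₀ G₁ Θ θ₀ 𝒦 u := by
  refine le_csSup ⟨1, ?_⟩ ⟨q, l, t, ht, δ, θ, hθ, θ', hθ', hu, hu', rfl⟩
  rintro r ⟨q, l, t, -, δ, θ, -, θ', hθ', -, -, rfl⟩
  exact abs_qfun_sub_le_one (hΘ.subset_admissible hθ') (hΘ.subset_admissible hθ₀) _ _ _ _ _ _

/-- The modulus `modq` tends to `0` at `0`: the continuity of `(t, θ, θ') ↦ 𝒒_δ(t, q, l; θ', θ)` is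
uniform in `t` over the compact interval `[0, 1]`. -/
theorem exists_modq_le (hreg : Regularity G₀ G₁ Θ t₁ t₂) (hθ₀ : θ₀ ∈ Θ) (𝒦 : Set ℝ) {η : ℝ}
    (hη : 0 < η) : ∃ r > 0, ∀ u < r, modq G₀ G₁ Θ θ₀ 𝒦 u ≤ η := by
  have h1 : ∀ (δ : Bool) (q l : Fin Q), ∃ r > 0, ∀ θ ∈ Θ, ∀ θ' ∈ Θ, ‖θ - θ₀‖ < r →
      ‖θ' - θ₀‖ < r → ∀ t ∈ Icc (0 : ℝ) 1,
        |qfun G₀ G₁ δ t q l θ' θ - qfun G₀ G₁ δ t q l θ₀ θ₀| ≤ η := by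
    intro δ q l
    have hc : ContinuousOn (Function.uncurry fun (p : Param Q d₀ d₁ × Param Q d₀ d₁) (t : ℝ) =>
        qfun G₀ G₁ δ t q l p.2 p.1) ((Θ ×ˢ Θ) ×ˢ Icc (0 : ℝ) 1) :=
      (hreg.continuousOn δ q l).comp (f := fun p : (Param Q d₀ d₁ × Param Q d₀ d₁) × ℝ =>
        (p.2, p.1)) (by fun_prop) fun p hp => ⟨hp.2, hp.1⟩
    obtain ⟨v, hv, hv'⟩ := isCompact_Icc.mem_uniformity_of_prod hc (q := (θ₀, θ₀))
      ⟨hθ₀, hθ₀⟩ (Metric.dist_mem_uniformity hη)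
    obtain ⟨r, hr, hrv⟩ := Metric.mem_nhdsWithin_iff.1 hv
    refine ⟨r, hr, fun θ hθ θ' hθ' h h' t ht => ?_⟩
    have hmem : (θ, θ') ∈ v := by
      refine hrv ⟨?_, hθ, hθ'⟩
      rw [Metric.mem_ball, Prod.dist_eq, max_lt_iff, dist_eq_norm, dist_eq_norm]
      exact ⟨h, h'⟩
    have := hv' _ hmem t ht
    exact le_of_lt (by simpa [Real.dist_eq] using this)
  choose r hr hr' using h1
  have h2 : ∃ ρ > 0, ∀ δ q l, ρ ≤ r δ q l := by
    have hev : ∀ᶠ ρ in 𝓝[>] (0 : ℝ), ∀ δ q l, ρ ≤ r δ q l := by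
      simp only [eventually_all]
      exact fun δ q l => mem_of_superset (Ioo_mem_nhdsGT (hr δ q l)) fun x hx => hx.2.le
    obtain ⟨ρ, hρ, hρ'⟩ := (hev.and self_mem_nhdsWithin).exists
    exact ⟨ρ, hρ', hρ⟩
  obtain ⟨ρ, hρ, hρr⟩ := h2
  refine ⟨ρ, hρ, fun u hu => Real.sSup_le ?_ hη.le⟩
  rintro _ ⟨q, l, t, ⟨y, -, rfl⟩, δ, θ, hθ, θ', hθ', h, h', rfl⟩
  exact hr' δ q l θ hθ θ' hθ' (h.trans_lt (hu.trans_le (hρr δ q l)))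
    (h'.trans_lt (hu.trans_le (hρr δ q l))) _ (thr_mem_Icc y)

end Moduli

/-! ### A rejection threshold common to all nearby parameters -/

/-- The deterministic part of the argument: for parameters `θ` that are `ε`-close to `θ₀`, the
`q`-value procedure rejects all the `ℓ`-values below the threshold `t = T_{θ₀}(α - u)`, where
`u = 8 κ⁻¹ (𝒲_{θ₀,𝒒}(ε) + 3 Q² ε)`, and the power of this threshold is close to that of
`T_{θ₀}(α)`. -/
theorem exists_uniform_threshold (hΘ : IsParamSpace G₀ G₁ Θ) (hreg : Regularity G₀ G₁ Θ t₁ t₂)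
    (hθ₀ : θ₀ ∈ Θ) {α a b : ℝ} (ha : alphaStar G₀ G₁ t₁ θ₀ < a) (hα : α ∈ Ioo a b) :
    ∃ e ∈ Ioo (0 : ℝ) 1, ∀ ε ∈ Ioo 0 e, ∃ t ∈ Icc (0 : ℝ) 1,
      ∀ θ ∈ Θ, ‖θ - θ₀‖ ≤ ε → (∀ s ≤ t, mfdr G₀ G₁ θ θ s ≤ α) ∧
        ∀ q l, qfun G₀ G₁ true (thr G₀ G₁ θ₀ α) q l θ₀ θ₀ - modq G₀ G₁ Θ θ₀ (Icc a b) ε -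
          modq1 G₀ G₁ θ₀ α (Icc a b) (modT G₀ G₁ θ₀ α (Icc a b)
              (8 * (kappa G₀ G₁ θ₀ a)⁻¹ *
                (modq G₀ G₁ Θ θ₀ (Icc a b) ε + 3 * (Q : ℝ) ^ 2 * ε))) ≤
            qfun G₀ G₁ true t q l θ₀ θ := by
  have hadm := hΘ.subset_admissible hθ₀
  set κ := kappa G₀ G₁ θ₀ a with hκ
  have hκ' : κ = totalMass G₀ G₁ θ₀ (thr G₀ G₁ θ₀ a) := rfl
  obtain ⟨hκ0, -, hmono⟩ := thr_spec hΘ hreg hθ₀ ha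
  rw [← hκ'] at hκ0
  -- `e` ensures that `8 κ⁻¹ (𝒲_{θ₀,𝒒}(ε) + 3 Q² ε) ≤ min (α - a) 4`
  set η := κ * min (α - a) 4 / 16 with hη
  have hαa : 0 < α - a := sub_pos.2 hα.1
  have hη0 : 0 < η := by positivity
  obtain ⟨r, hr, hrq⟩ := exists_modq_le hreg hθ₀ (Icc a b) hη0
  have hQ : (1 : ℝ) ≤ Q := by exact_mod_cast one_le_card_groups hadm
  have hQ2 : 0 < 3 * (Q : ℝ) ^ 2 := by positivity
  set e := min (1 / 2) (min r (η / (3 * (Q : ℝ) ^ 2))) with he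
  refine ⟨e, ⟨by positivity, (min_le_left _ _).trans_lt (by norm_num)⟩, fun ε hε => ?_⟩
  have hεr : ε < r := hε.2.trans_le ((min_le_right _ _).trans (min_le_left _ _))
  have hεQ : 3 * (Q : ℝ) ^ 2 * ε ≤ η := by
    have : ε ≤ η / (3 * (Q : ℝ) ^ 2) :=
      hε.2.le.trans ((min_le_right _ _).trans (min_le_right _ _))
    rw [le_div_iff₀ hQ2] at this
    linarith
  have hW := hrq ε hεr
  have hW0 := modq_nonneg (G₀ := G₀) (G₁ := G₁) (Θ := Θ) (θ₀ := θ₀) (𝒦 := Icc a b) ε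
  set W := modq G₀ G₁ Θ θ₀ (Icc a b) ε
  set D := W + 3 * (Q : ℝ) ^ 2 * ε with hD
  have hD0 : 0 ≤ D := add_nonneg hW0 (mul_nonneg hQ2.le hε.1.le)
  have hDη : D ≤ κ * min (α - a) 4 / 8 := by rw [hη] at *; linarith
  set u := 8 * κ⁻¹ * D with hu
  have hu0 : 0 ≤ u := by positivity
  have hu1 : u ≤ min (α - a) 4 := by
    calc u ≤ 8 * κ⁻¹ * (κ * min (α - a) 4 / 8) := by rw [hu]; gcongr
      _ = _ := by field_simp
  have hua : u ≤ α - a := hu1.trans (min_le_left _ _)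
  have hDκ : D ≤ κ / 2 := by
    have : κ * min (α - a) 4 ≤ κ * 4 := by gcongr; exact min_le_right _ _
    linarith
  set y := α - u with hy
  have hya : a ≤ y := by linarith
  have hyK : y ∈ Icc a b := ⟨hya, by linarith [hα.2]⟩
  set t := thr G₀ G₁ θ₀ y with ht
  have htK : t ∈ thr G₀ G₁ θ₀ '' Icc a b := mem_image_of_mem _ hyK
  refine ⟨t, thr_mem_Icc y, fun θ hθ hθε => ⟨fun s hs => ?_, fun q l => ?_⟩⟩
  · have hθ' := hΘ.subset_admissible hθ
    have hq : ∀ δ q l, |qfun G₀ G₁ δ t q l θ θ - qfun G₀ G₁ δ t q l θ₀ θ₀| ≤ W :=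
      le_modq hΘ hθ₀ htK hθ hθ hθε hθε
    have hκt : κ ≤ totalMass G₀ G₁ θ₀ t := by
      rw [hκ']
      exact totalMass_mono hadm (hmono y hya)
    calc mfdr G₀ G₁ θ θ s ≤ mfdr G₀ G₁ θ θ t := mfdr_mono hθ' hs
      _ ≤ mfdr G₀ G₁ θ₀ θ₀ t + 4 * κ⁻¹ * D :=
          mfdr_le_add hadm hκ0 hκt hDκ (abs_falseMass_sub_le hθ' hadm hθε hq)
            (abs_totalMass_sub_le hθ' hadm hθε hq)
      _ ≤ y + u := by
          have h1 := (thr_spec hΘ hreg hθ₀ (ha.trans_le hya)).2.1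
          have h2 : 4 * κ⁻¹ * D ≤ u := by
            have : 0 ≤ κ⁻¹ * D := by positivity
            rw [hu]; linarith
          linarith
      _ = α := by rw [hy]; ring
  · have h1 := le_modq hΘ hθ₀ htK hθ hθ₀ hθε (by simpa using hε.1.le) true q l
    have h2 : |t - thr G₀ G₁ θ₀ α| ≤ modT G₀ G₁ θ₀ α (Icc a b) u := by
      refine le_modT hyK ?_
      rw [hy, sub_sub_cancel_left, abs_neg, abs_of_nonneg hu0]
    have h3 := le_modq1 hadm htK h2 q l
    rw [abs_le] at h1 h3
    linarith [h1.1, h3.1]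

/-! ### Numerical comparison of the rates -/

section Numerics

/-- An upper bound on an exponential term gives a lower bound on its exponent, here compared with a
multiple of `log 2`, whose numerical value is available. -/
theorem log_two_mul_lt {c d r s : ℝ} (hd : 0 < d) (h : c * Real.exp (-s) < d)
    (hr : r * Real.log 2 ≤ Real.log (c / d)) (hc : 0 < c) : r * Real.log 2 < s := by
  refine hr.trans_lt ?_
  rw [Real.log_lt_iff_lt_exp (div_pos hc hd), div_lt_iff₀ hd]
  rw [Real.exp_neg, ← div_eq_mul_inv, div_lt_iff₀ (Real.exp_pos s)] at h
  linarith

theorem rate_le_of_sq_le {m n c x r s : ℝ} (hm : 0 < m) (hn : 0 < n) (hx : 0 < x) (hr : 0 < r)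
    (hs : 0 < s) (hrs : 4 / r + 1 / (2 * s) ≤ 1) (h1 : (c * r) ^ 2 ≤ m * x ^ 2)
    (h2 : s ^ 2 ≤ n * x ^ 2) : 4 * c / √m + 1 / (2 * √n) ≤ x := by
  have hm' := Real.sqrt_pos.2 hm
  have hn' := Real.sqrt_pos.2 hn
  have h3 : c * r ≤ √m * x := by
    refine abs_le_of_sq_le_sq' ?_ (by positivity) |>.2
    rwa [mul_pow (√m), Real.sq_sqrt hm.le]
  have h4 : s ≤ √n * x := by
    refine abs_le_of_sq_le_sq' ?_ (by positivity) |>.2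
    rwa [mul_pow (√n), Real.sq_sqrt hn.le]
  have h5 : 4 * c / √m ≤ 4 / r * x := by
    rw [div_le_iff₀ hm', div_mul_eq_mul_div, div_mul_eq_mul_div, le_div_iff₀ hr]
    linarith
  have h6 : 1 / (2 * √n) ≤ 1 / (2 * s) * x := by
    rw [div_le_iff₀ (by positivity), div_mul_eq_mul_div, div_mul_eq_mul_div,
      le_div_iff₀ (by positivity)]
    linarith
  calc _ ≤ (4 / r + 1 / (2 * s)) * x := by linarith
    _ ≤ 1 * x := by gcongr
    _ = x := one_mul x

/-- When the exponential terms do not make the bound trivial, `x` dominates the mean deviations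
`4 K Q / √m` (empirical processes) and `1 / (2 √n)` (number of edges). -/
theorem rate_le {n K Q : ℕ} (hn : 2 ≤ n) (hK : 0 < K) (hQ : 0 < Q) {x p w : ℝ} (hx : 0 < x)
    (hx1 : x < 1) (hpw : p ^ 2 * w * (Q : ℝ) ^ 2 ≤ 1)
    (h : x + 2 * (Q : ℝ) ^ 2 *
              Real.exp (-(2 * ((n / 2 : ℕ) : ℝ) * x ^ 2 / (9 * (Q : ℝ) ^ 4))) +
          6 * (K : ℝ) * (Q : ℝ) ^ 2 *
              Real.exp (-(((n : ℝ) * ((n : ℝ) - 1) / 2) * p ^ 2 * w * x ^ 2 /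
                (9 * (K : ℝ) ^ 2))) < 1) :
    4 * (K * Q) / √((n : ℝ) * (n - 1) / 2) + 1 / (2 * √n) ≤ x := by
  have hL := Real.log_two_gt_d9
  have hn' : (2 : ℝ) ≤ n := by exact_mod_cast hn
  have hK' : (1 : ℝ) ≤ K := by exact_mod_cast hK
  have hQ' : (1 : ℝ) ≤ Q := by exact_mod_cast hQ
  set m : ℝ := (n : ℝ) * (n - 1) / 2 with hm
  have hm0 : 0 < m := by
    have : (0 : ℝ) < n - 1 := by linarith
    positivity
  set s₁ : ℝ := 2 * ((n / 2 : ℕ) : ℝ) * x ^ 2 / (9 * (Q : ℝ) ^ 4) with hs₁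
  set s₂ : ℝ := m * p ^ 2 * w * x ^ 2 / (9 * (K : ℝ) ^ 2) with hs₂
  have hQ2 : (1 : ℝ) ≤ (Q : ℝ) ^ 2 := one_le_pow₀ hQ'
  have hQ4 : (1 : ℝ) ≤ (Q : ℝ) ^ 4 := one_le_pow₀ hQ'
  have hE1 : 0 < 2 * (Q : ℝ) ^ 2 * Real.exp (-s₁) := by positivity
  have hE2 : 0 < 6 * (K : ℝ) * (Q : ℝ) ^ 2 * Real.exp (-s₂) := by positivity
  -- the exponents are at most `n x² / 9` and `m x² / (9 K² Q²)`
  have h1 : 9 * s₁ ≤ n * x ^ 2 := by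
    have e : 9 * s₁ * (Q : ℝ) ^ 4 = 2 * ((n / 2 : ℕ) : ℝ) * x ^ 2 := by rw [hs₁]; field_simp
    have h2 : 2 * ((n / 2 : ℕ) : ℝ) ≤ n := by
      have : 2 * (n / 2) ≤ n := by omega
      exact_mod_cast this
    have h3 : 0 ≤ s₁ := by positivity
    calc 9 * s₁ ≤ 9 * s₁ * (Q : ℝ) ^ 4 := le_mul_of_one_le_right (by positivity) hQ4
      _ ≤ _ := by rw [e]; gcongr
  have h2 : 9 * s₂ * (K * Q) ^ 2 ≤ m * x ^ 2 := by
    have e : 9 * s₂ * (K * Q) ^ 2 = m * x ^ 2 * (p ^ 2 * w * (Q : ℝ) ^ 2) := by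
      rw [hs₂]; field_simp
    rw [e]
    exact mul_le_of_le_one_right (by positivity) hpw
  have hs1 : Real.log 2 < s₁ := by
    have := log_two_mul_lt (r := 1) one_pos (show 2 * (Q : ℝ) ^ 2 * Real.exp (-s₁) < 1 by linarith)
      (by rw [one_mul, div_one]; exact Real.log_le_log two_pos (by linarith)) (by positivity)
    linarith
  have hs1' : 2 * (Q : ℝ) ^ 2 * Real.exp (-s₁) < 1 / 2 → 2 * Real.log 2 < s₁ := fun hlt =>
    log_two_mul_lt (by norm_num) hlt (by
      rw [show (2 : ℝ) * Real.log 2 = Real.log (2 ^ 2) by rw [Real.log_pow]; norm_num]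
      exact Real.log_le_log (by norm_num) (by linarith)) (by positivity)
  have hx3 : 1 / 2 ≤ 2 * (Q : ℝ) ^ 2 * Real.exp (-s₁) → x < 1 / 2 := fun hc => by linarith
  by_cases hKQ : 2 ≤ K * Q ^ 2
  · have hKQ' : (2 : ℝ) ≤ K * (Q : ℝ) ^ 2 := by exact_mod_cast hKQ
    have hsq : 0 < ((K : ℝ) * Q) ^ 2 := by positivity
    -- one of the two exponential terms is below `1 / 2`
    rcases lt_or_ge (2 * (Q : ℝ) ^ 2 * Real.exp (-s₁)) (1 / 2) with hc | hc
    · have h3 := hs1' hc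
      have h4 : 7 / 2 * Real.log 2 < s₂ := log_two_mul_lt one_pos
        (show 6 * (K : ℝ) * (Q : ℝ) ^ 2 * Real.exp (-s₂) < 1 by linarith) (by
          have h5 : Real.log (2 ^ 7) ≤ Real.log (12 ^ 2) :=
            Real.log_le_log (by norm_num) (by norm_num)
          rw [Real.log_pow, Real.log_pow] at h5
          have h6 : Real.log 12 ≤ Real.log (6 * (K : ℝ) * (Q : ℝ) ^ 2 / 1) :=
            Real.log_le_log (by norm_num) (by linarith)
          push_cast at h5
          linarith) (by positivity)
      refine rate_le_of_sq_le (r := 4.67) (s := 3.53) hm0 (by linarith) hx (by norm_num)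
        (by norm_num) (by norm_num) ?_ (by linarith)
      refine le_trans ?_ h2
      rw [mul_pow, mul_comm]
      gcongr
      linarith
    · have h4 : 9 / 2 * Real.log 2 < s₂ := log_two_mul_lt (d := 1 / 2) (by norm_num)
        (show 6 * (K : ℝ) * (Q : ℝ) ^ 2 * Real.exp (-s₂) < 1 / 2 by linarith) (by
          have h5 : Real.log (2 ^ 9) ≤ Real.log (24 ^ 2) :=
            Real.log_le_log (by norm_num) (by norm_num)
          rw [Real.log_pow, Real.log_pow] at h5
          have h6 : Real.log 24 ≤ Real.log (6 * (K : ℝ) * (Q : ℝ) ^ 2 / (1 / 2)) :=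
            Real.log_le_log (by norm_num) (by linarith)
          push_cast at h5
          linarith) (by positivity)
      refine rate_le_of_sq_le (r := 5.29) (s := 2.49) hm0 (by linarith) hx (by norm_num)
        (by norm_num) (by norm_num) ?_ (by linarith)
      refine le_trans ?_ h2
      rw [mul_pow, mul_comm]
      gcongr
      linarith
  · -- for `K = Q = 1`, since `x < 1` the graph has so many vertices that `m` is far above `n`
    have hK1 : K = 1 := by
      by_contra hne
      exact hKQ (by nlinarith [show 2 ≤ K by omega, Nat.one_le_pow 2 Q hQ])
    have hQ1 : Q = 1 := by
      by_contra hne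
      exact hKQ (by nlinarith [show 2 ≤ Q by omega])
    subst hK1 hQ1
    have key : ∀ N : ℕ, (N : ℝ) * x ^ 2 < 18 * s₁ → N < 2 * n := by
      intro N hN
      have : (N : ℝ) * x ^ 2 < (2 * n : ℕ) * x ^ 2 := by push_cast; linarith
      exact_mod_cast lt_of_mul_lt_mul_right this (by positivity)
    have hx2 : x ^ 2 < 1 := by nlinarith
    have h3 : 74 ≤ m * x ^ 2 := by
      rcases lt_or_ge (2 * ((1 : ℕ) : ℝ) ^ 2 * Real.exp (-s₁)) (1 / 2) with hc | hc
      · have h4 := hs1' hc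
        have h5 : (13 : ℝ) ≤ n := by
          have := key 24 (by push_cast; linarith)
          exact_mod_cast (show 13 ≤ n by omega)
        have h6 : 6 * (n * x ^ 2) ≤ m * x ^ 2 := by
          rw [← mul_assoc, hm]
          gcongr
          nlinarith
        linarith
      · have hx4 := hx3 hc
        have h5 : (25 : ℝ) ≤ n := by
          have := key 48 (by push_cast; nlinarith)
          exact_mod_cast (show 25 ≤ n by omega)
        have h6 : 12 * (n * x ^ 2) ≤ m * x ^ 2 := by
          rw [← mul_assoc, hm]
          gcongr
          nlinarith
        linarith
    exact rate_le_of_sq_le (r := 8.6) (s := 2.49) hm0 (by linarith) hx (by norm_num)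
        (by norm_num) (by norm_num) (by norm_num; linarith) (by linarith)

end Numerics

/-! ### Relabelling of the groups -/

section Relabelling

/-- Labels are integers, so estimators at distance less than `1` recover the clustering exactly, up
to a relabelling. -/
theorem exists_relabel_of_pairDist_le {θ' : Param Q d₀ d₁} {z' z : Fin n → Fin Q} {ε : ℝ}
    (hε : ε < 1) (h : pairDist θ' z' θ z ≤ ε) :
    ∃ σ : Equiv.Perm (Fin Q), ‖θ'.relabel σ - θ‖ ≤ ε ∧ ∀ i, z' i = σ (z i) := by
  obtain ⟨σ, hσ⟩ := exists_eq_ciInf_of_finite (f := fun σ : Equiv.Perm (Fin Q) =>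
    max ‖θ'.relabel σ - θ‖ ‖fun i => ((z' i : ℕ) : ℝ) - ((σ (z i) : ℕ) : ℝ)‖)
  have h' := hσ.le.trans h
  refine ⟨σ, (le_max_left _ _).trans h', fun i => ?_⟩
  have h1 : |((z' i : ℕ) : ℝ) - ((σ (z i) : ℕ) : ℝ)| < 1 :=
    ((norm_le_pi_norm (fun i => ((z' i : ℕ) : ℝ) - ((σ (z i) : ℕ) : ℝ)) i).trans
      ((le_max_right _ _).trans h')).trans_lt hε
  have h2 : |((z' i : ℕ) : ℤ) - ((σ (z i) : ℕ) : ℤ)| < 1 := by exact_mod_cast h1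
  rw [Int.abs_lt_one_iff] at h2
  exact Fin.ext (by omega)

theorem qvalue_relabel {x : Obs n} {z' z : Fin n → Fin Q} {σ : Equiv.Perm (Fin Q)}
    (h : ∀ i, z' i = σ (z i)) (e : Edge n) :
    qvalue G₀ G₁ x z' θ e = qvalue G₀ G₁ x z (θ.relabel σ) e := by
  rw [qvalue, qvalue, mfdr_relabel, lvalue, lvalue, h, h]
  rfl

theorem measurable_pairDist {θhat : Obs n → Param Q d₀ d₁} {Zhat : Obs n → Fin n → Fin Q}
    (hθ : Measurable θhat) (hZ : Measurable Zhat) (z : Fin n → Fin Q) :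
    Measurable fun x => pairDist (θhat x) (Zhat x) θ z := by
  refine Measurable.iInf fun σ => Measurable.max ?_ ?_
  · have hc : Continuous fun θ' : Param Q d₀ d₁ => ‖θ'.relabel σ - θ‖ := by
      unfold Param.relabel Param.grp Param.con Param.nul Param.eff
      fun_prop
    exact hc.measurable.comp hθ
  · have hd : Measurable fun z' : Fin n → Fin Q =>
        ‖fun i => ((z' i : ℕ) : ℝ) - ((σ (z i) : ℕ) : ℝ)‖ := Measurable.of_discrete
    exact hd.comp hZ

end Relabelling

/-! ### Integration under the law of the model -/

section ObservationLaw

/-- The law of `X` given `Z = z` and `A = a`. -/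
noncomputable def obsLaw (G₀ : DensityFamily d₀) (G₁ : DensityFamily d₁) (θ : Param Q d₀ d₁)
    (z : Fin n → Fin Q) (a : Edge n → Bool) : Measure (Obs n) :=
  Measure.pi fun e : Edge n => noiseLaw G₀ G₁ θ (a e) (z e.1.1) (z e.1.2)

theorem isProbabilityMeasure_obsLaw (hθ : θ ∈ admissible G₀ G₁) (z : Fin n → Fin Q)
    (a : Edge n → Bool) : IsProbabilityMeasure (obsLaw G₀ G₁ θ z a) := by
  have := fun e : Edge n => isProbabilityMeasure_noiseLaw hθ (a e) (z e.1.1) (z e.1.2)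
  unfold obsLaw
  infer_instance

theorem measurableEmbedding_sample (z : Fin n → Fin Q) (a : Edge n → Bool) :
    MeasurableEmbedding fun x : Obs n => ((z, a, x) : Sample n Q) :=
  (measurableEmbedding_prodMk_left z).comp (measurableEmbedding_prodMk_left a)

/-- Integration under the law of `(Z, A, X)`: first over `X` given `(Z, A)`, then over `(Z, A)`. -/
theorem integral_law (hθ : θ ∈ admissible G₀ G₁) (f : Sample n Q → ℝ)
    (hf : ∀ z a, Integrable (fun x => f (z, a, x)) (obsLaw G₀ G₁ θ z a)) :
    ∫ s, f s ∂(law G₀ G₁ n θ) =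
      latentMean θ fun z a => ∫ x, f (z, a, x) ∂(obsLaw G₀ G₁ θ z a) := by
  have h1 : ∀ z a, Integrable f (ENNReal.ofReal (latentProb θ z a) •
      (obsLaw G₀ G₁ θ z a).map fun x => ((z, a, x) : Sample n Q)) := fun z a =>
    (((measurableEmbedding_sample z a).integrable_map_iff).2 (hf z a)).smul_measure
      ENNReal.ofReal_ne_top
  have h2 : law G₀ G₁ n θ = ∑ z : Fin n → Fin Q, ∑ a : Edge n → Bool,
      ENNReal.ofReal (latentProb θ z a) •
        (obsLaw G₀ G₁ θ z a).map fun x => ((z, a, x) : Sample n Q) := rfl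
  rw [h2, integral_finsetSum_measure fun z _ => integrable_finsetSum_measure.2 fun a _ => h1 z a]
  refine Finset.sum_congr rfl fun z _ => ?_
  rw [integral_finsetSum_measure fun a _ => h1 z a]
  refine Finset.sum_congr rfl fun a _ => ?_
  rw [integral_smul_measure, (measurableEmbedding_sample z a).integral_map,
    ENNReal.toReal_ofReal (latentProb_nonneg hθ z a), smul_eq_mul]

theorem law_real (hθ : θ ∈ admissible G₀ G₁) {S : Set (Sample n Q)}
    (hS : MeasurableSet S) :
    (law G₀ G₁ n θ).real S =
      latentMean θ fun z a => (obsLaw G₀ G₁ θ z a).real {x | (z, a, x) ∈ S} := by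
  rw [← integral_indicator_one hS, integral_law hθ]
  · congr 1
    funext z a
    exact integral_indicator_one ((measurableEmbedding_sample z a).measurable hS)
  · intro z a
    have := isProbabilityMeasure_obsLaw hθ z a
    exact (integrable_const (1 : ℝ)).indicator ((measurableEmbedding_sample z a).measurable hS)

theorem pi1_pos (hθ : θ ∈ admissible G₀ G₁) : 0 < θ.pi1 := by
  have : NeZero Q := ⟨by have := one_le_card_groups hθ; omega⟩
  have hpos : ∀ q l, 0 < θ.grp q * θ.grp l * θ.con q l := fun q l =>
    mul_pos (mul_pos (hθ.1 q) (hθ.1 l)) (hθ.2.2.1 q l).1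
  exact Finset.sum_pos (fun q _ => Finset.sum_pos (fun l _ => hpos q l) Finset.univ_nonempty)
    Finset.univ_nonempty

theorem card_edge_pos (hn : 2 ≤ n) : (0 : ℝ) < Fintype.card (Edge n) := by
  rw [card_edge]
  have hn' : (2 : ℝ) ≤ n := by exact_mod_cast hn
  have : (0 : ℝ) < n - 1 := by linarith
  positivity

theorem pi1_mul_tdr (hθ : θ ∈ admissible G₀ G₁) (hn : 2 ≤ n) (φ : Sample n Q → Edge n → ℝ)
    (hφ : ∀ z a, Integrable (fun x => ∑ e, (if a e then 1 else 0) * φ (z, a, x) e)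
      (obsLaw G₀ G₁ θ z a)) :
    θ.pi1 * tdr G₀ G₁ θ φ = (latentMean θ fun z a =>
      ∫ x, ∑ e, (if a e then 1 else 0) * φ (z, a, x) e ∂(obsLaw G₀ G₁ θ z a)) /
        Fintype.card (Edge n) := by
  have h1 : ∫ s, ∑ e, (if s.2.1 e then (1 : ℝ) else 0) ∂(law G₀ G₁ n θ) =
      Fintype.card (Edge n) * θ.pi1 := by
    rw [integral_law hθ _ fun z a => ?_, ← latentMean_edges hθ]
    · congr 1
      funext z a
      have := isProbabilityMeasure_obsLaw hθ z a
      change ∫ _, (∑ e, if a e then (1 : ℝ) else 0) ∂(obsLaw G₀ G₁ θ z a) = _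
      rw [integral_const, probReal_univ, one_smul]
    · have := isProbabilityMeasure_obsLaw hθ z a
      exact integrable_const (∑ e, if a e then (1 : ℝ) else 0)
  rw [tdr, h1, integral_law hθ _ hφ]
  have := pi1_pos hθ
  have := card_edge_pos hn
  field_simp

end ObservationLaw

/-! ### True discoveries of the plug-in and of the oracle procedures -/

section Discoveries

theorem sum_edges_le_card (a : Edge n → Bool) :
    ∑ e, (if a e then (1 : ℝ) else 0) ≤ Fintype.card (Edge n) := by
  rw [← Finset.card_univ, Finset.cast_card]
  exact Finset.sum_le_sum fun e _ => by split_ifs <;> norm_num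

/-- Cauchy-Schwarz over the `Q ^ 2` group pairs. -/
theorem sum_sqrt_card_le (z : Fin n → Fin Q) (a : Edge n → Bool) :
    ∑ p : Fin Q × Fin Q, √((Finset.univ.filter fun e : Edge n => a e).filter
      fun e => (z e.1.1, z e.1.2) = p).card ≤ Q * √(Fintype.card (Edge n)) := by
  refine abs_le_of_sq_le_sq' ?_ (by positivity) |>.2
  refine (sq_sum_le_card_mul_sum_sq (s := Finset.univ)).trans ?_
  rw [mul_pow, Real.sq_sqrt (Nat.cast_nonneg _)]
  simp only [Real.sq_sqrt (Nat.cast_nonneg _), ← Nat.cast_sum]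
  rw [Finset.card_univ, Fintype.card_prod, Fintype.card_fin, ← sq]
  have h : ∑ p : Fin Q × Fin Q, ((Finset.univ.filter fun e : Edge n => a e).filter
      fun e => (z e.1.1, z e.1.2) = p).card = (Finset.univ.filter fun e : Edge n => a e).card := by
    rw [Finset.card_eq_sum_card_fiberwise (f := fun e : Edge n => (z e.1.1, z e.1.2))
      (t := Finset.univ) (by simp)]
  rw [h]
  push_cast
  gcongr
  exact Finset.card_le_univ _

/-- Uniform lower bound, over all `θ ∈ Θ` and all thresholds, for the number of detected edges
given `(Z, A)`: the error is a random variable whose mean is at most `4 K Q √m`. -/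
theorem exists_uniform_error {K : ℕ} (hcomp : Complexity G₀ G₁ Θ K)
    (hθ₀ : θ₀ ∈ admissible G₀ G₁) (z : Fin n → Fin Q) (a : Edge n → Bool) :
    ∃ B : Obs n → ℝ, Integrable B (obsLaw G₀ G₁ θ₀ z a) ∧ (∀ x, 0 ≤ B x) ∧
      ∫ x, B x ∂(obsLaw G₀ G₁ θ₀ z a) ≤ 4 * (K * Q) * √(Fintype.card (Edge n)) ∧
      ∀ θ ∈ Θ, ∀ t ∈ Icc (0 : ℝ) 1, ∀ x : Obs n,
        ∑ e, (if a e then 1 else 0) * qfun G₀ G₁ true t (z e.1.1) (z e.1.2) θ₀ θ - B x ≤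
          ∑ e, (if a e then 1 else 0) *
            (if lfun G₀ G₁ (x e) (z e.1.1) (z e.1.2) θ ≤ t then 1 else 0) := by
  have hprob := fun e : Edge n => isProbabilityMeasure_noiseLaw hθ₀ (a e) (z e.1.1) (z e.1.2)
  set I : Fin Q × Fin Q → Finset (Edge n) := fun p =>
    (Finset.univ.filter fun e : Edge n => a e).filter fun e => (z e.1.1, z e.1.2) = p with hI
  choose B hBi hB0 hBm hB using fun p : Fin Q × Fin Q => exists_empirical_bound
    (fun e : Edge n => noiseLaw G₀ G₁ θ₀ (a e) (z e.1.1) (z e.1.2)) (I p) K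
  refine ⟨fun x => ∑ p, B p x, integrable_finsetSum _ fun p _ => hBi p,
    fun x => Finset.sum_nonneg fun p _ => hB0 p x, ?_, fun θ hθ t ht x => ?_⟩
  · calc _ = ∑ p, ∫ x, B p x ∂(obsLaw G₀ G₁ θ₀ z a) := integral_finsetSum _ fun p _ => hBi p
      _ ≤ ∑ p, 4 * K * √(I p).card := Finset.sum_le_sum fun p _ => hBm p
      _ = 4 * K * ∑ p, √(I p).card := by rw [Finset.mul_sum]
      _ ≤ 4 * K * (Q * √(Fintype.card (Edge n))) := by
          gcongr
          exact sum_sqrt_card_le z a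
      _ = _ := by ring
  · have hfib : ∀ F : Edge n → ℝ, ∑ e, (if a e then 1 else 0) * F e = ∑ p, ∑ e ∈ I p, F e := by
      intro F
      rw [hI, Finset.sum_fiberwise, Finset.sum_filter]
      exact Finset.sum_congr rfl fun e _ => by split_ifs <;> simp
    rw [hfib, hfib, sub_le_iff_le_add, ← Finset.sum_add_distrib]
    refine Finset.sum_le_sum fun p _ => ?_
    have h := hB p {y | lfun G₀ G₁ y p.1 p.2 θ ≤ t} (hcomp θ hθ p.1 p.2 t ht) x
    rw [Finset.sum_sub_distrib, sub_le_iff_le_add'] at h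
    refine le_trans (le_of_eq ?_) (h.trans (le_of_eq ?_))
    · refine Finset.sum_congr rfl fun e he => ?_
      simp only [hI, Finset.mem_filter, Finset.mem_univ, true_and] at he
      rw [← he.2, he.1]
      rfl
    · congr 1
      refine Finset.sum_congr rfl fun e he => ?_
      simp only [hI, Finset.mem_filter, Finset.mem_univ, true_and] at he
      rw [← he.2, indicator_apply]
      rfl

theorem plugIn_nonneg {θhat : Obs n → Param Q d₀ d₁} {Zhat : Obs n → Fin n → Fin Q} {α : ℝ}
    (x : Obs n) (e : Edge n) : 0 ≤ plugIn G₀ G₁ θhat Zhat α x e := by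
  unfold plugIn; split_ifs <;> norm_num

theorem plugIn_le_one {θhat : Obs n → Param Q d₀ d₁} {Zhat : Obs n → Fin n → Fin Q} {α : ℝ}
    (x : Obs n) (e : Edge n) : plugIn G₀ G₁ θhat Zhat α x e ≤ 1 := by
  unfold plugIn; split_ifs <;> norm_num

theorem integrable_detections {P : Measure (Obs n)} [IsProbabilityMeasure P] (a : Edge n → Bool)
    {φ : Obs n → Edge n → ℝ} (hφ : Measurable φ) (h0 : ∀ x e, 0 ≤ φ x e)
    (h1 : ∀ x e, φ x e ≤ 1) :
    Integrable (fun x => ∑ e, (if a e then 1 else 0) * φ x e) P := by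
  refine integrable_finsetSum _ fun e _ => Integrable.const_mul ?_ _
  refine Integrable.of_bound ((measurable_pi_apply e).comp hφ).aestronglyMeasurable 1
    (ae_of_all _ fun x => ?_)
  rw [Real.norm_of_nonneg (h0 x e)]
  exact h1 x e

variable {α t Δ ε : ℝ} {c : Fin Q → Fin Q → ℝ}

/-- Lower bound for the number of true discoveries of the plug-in procedure given `(Z, A)`. On the
event that the estimators are `ε`-close to the truth, a relabelling `θ` of the estimated
parameter is `ε`-close to `θ₀`, and the procedure rejects the edges with
`ℓ(X_{i,j}, Z_i, Z_j, θ) ≤ t`. -/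
theorem sum_le_integral_plugIn (hΘ : IsParamSpace G₀ G₁ Θ) (hθ₀ : θ₀ ∈ admissible G₀ G₁) {K : ℕ}
    (hcomp : Complexity G₀ G₁ Θ K) {θhat : Obs n → Param Q d₀ d₁} {Zhat : Obs n → Fin n → Fin Q}
    (hθhat : ∀ x, θhat x ∈ Θ) (hθm : Measurable θhat) (hZm : Measurable Zhat)
    (hφ : Measurable (plugIn G₀ G₁ θhat Zhat α)) (hε : ε < 1) (ht : t ∈ Icc (0 : ℝ) 1)
    (hΔ : 0 ≤ Δ) (hc : ∀ q l, c q l ≤ 1)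
    (hstep : ∀ θ ∈ Θ, ‖θ - θ₀‖ ≤ ε → (∀ s ≤ t, mfdr G₀ G₁ θ θ s ≤ α) ∧
      ∀ q l, c q l - Δ ≤ qfun G₀ G₁ true t q l θ₀ θ)
    (z : Fin n → Fin Q) (a : Edge n → Bool) :
    ∑ e, (if a e then 1 else 0) * (c (z e.1.1) (z e.1.2) - Δ) -
        4 * (K * Q) * √(Fintype.card (Edge n)) -
        (∑ e, if a e then 1 else 0) *
          (obsLaw G₀ G₁ θ₀ z a).real {x | ε < pairDist (θhat x) (Zhat x) θ₀ z} ≤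
      ∫ x, ∑ e, (if a e then 1 else 0) * plugIn G₀ G₁ θhat Zhat α x e
        ∂(obsLaw G₀ G₁ θ₀ z a) := by
  have := isProbabilityMeasure_obsLaw hθ₀ z a
  obtain ⟨B, hBi, hB0, hBm, hB⟩ := exists_uniform_error hcomp hθ₀ z a
  set S : Set (Obs n) := {x | ε < pairDist (θhat x) (Zhat x) θ₀ z} with hS
  have hSm : MeasurableSet S :=
    measurableSet_lt measurable_const (measurable_pairDist hθm hZm z)
  set M : ℝ := ∑ e, if a e then 1 else 0 with hM
  set C : ℝ := ∑ e, (if a e then 1 else 0) * (c (z e.1.1) (z e.1.2) - Δ) with hC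
  have hpt : ∀ x, C - B x - M * S.indicator 1 x ≤
      ∑ e, (if a e then 1 else 0) * plugIn G₀ G₁ θhat Zhat α x e := by
    intro x
    by_cases hx : x ∈ S
    · rw [indicator_of_mem hx, Pi.one_apply, mul_one]
      have h1 : C ≤ M := Finset.sum_le_sum fun e _ => by
        split_ifs
        · linarith [hc (z e.1.1) (z e.1.2)]
        · simp
      have h2 : 0 ≤ ∑ e, (if a e then 1 else 0) * plugIn G₀ G₁ θhat Zhat α x e :=
        Finset.sum_nonneg fun e _ => mul_nonneg (by split_ifs <;> norm_num) (plugIn_nonneg x e)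
      linarith [hB0 x]
    · rw [indicator_of_notMem hx, mul_zero, sub_zero]
      obtain ⟨σ, hσ, hz⟩ := exists_relabel_of_pairDist_le hε (not_lt.1 hx)
      have hmem := hΘ.relabel_mem _ (hθhat x) σ
      obtain ⟨h1, h2⟩ := hstep _ hmem hσ
      refine le_trans ?_ ((hB _ hmem t ht x).trans ?_)
      · refine sub_le_sub_right (Finset.sum_le_sum fun e _ => ?_) _
        exact mul_le_mul_of_nonneg_left (h2 _ _) (by split_ifs <;> norm_num)
      · refine Finset.sum_le_sum fun e _ => ?_
        refine mul_le_mul_of_nonneg_left ?_ (by split_ifs <;> norm_num)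
        split_ifs with hl
        · rw [plugIn, qvalue_relabel hz, if_pos]
          exact h1 _ hl
        · exact plugIn_nonneg x e
  have hSi : Integrable (S.indicator (1 : Obs n → ℝ)) (obsLaw G₀ G₁ θ₀ z a) :=
    (integrable_const (1 : ℝ)).indicator hSm
  have hint := integral_mono (((integrable_const C).sub hBi).sub (hSi.const_mul M))
    (integrable_detections (P := obsLaw G₀ G₁ θ₀ z a) a hφ plugIn_nonneg plugIn_le_one) hpt
  have e1 := integral_sub ((integrable_const C).sub hBi) (hSi.const_mul M)
  have e2 := integral_sub (integrable_const (μ := obsLaw G₀ G₁ θ₀ z a) C) hBi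
  simp only [Pi.sub_apply] at e1 hint
  rw [e1, e2, integral_const_mul, integral_indicator_one hSm, integral_const, probReal_univ,
    one_smul] at hint
  linarith

theorem measurable_oracle (hθ₀ : θ₀ ∈ admissible G₀ G₁) (z : Fin n → Fin Q) (a : Edge n → Bool) :
    Measurable fun (x : Obs n) (e : Edge n) => oracle G₀ G₁ θ₀ α (z, a, x) e := by
  refine measurable_pi_lambda _ fun e => Measurable.ite ?_ measurable_const measurable_const
  exact ((mfdr_mono hθ₀).measurable.comp ((measurable_lfun hθ₀ (z e.1.1) (z e.1.2)).comp
    (measurable_pi_apply e))) measurableSet_Iic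

theorem oracle_nonneg (s : Sample n Q) (e : Edge n) : 0 ≤ oracle G₀ G₁ θ₀ α s e := by
  unfold oracle; split_ifs <;> norm_num

theorem oracle_le_one (s : Sample n Q) (e : Edge n) : oracle G₀ G₁ θ₀ α s e ≤ 1 := by
  unfold oracle; split_ifs <;> norm_num

/-- The oracle rejects only `ℓ`-values at most `T_{θ₀}(α)`, by the definition of `T_{θ₀}`. -/
theorem integral_oracle_le (hθ₀ : θ₀ ∈ admissible G₀ G₁) (z : Fin n → Fin Q)
    (a : Edge n → Bool) :
    ∫ x, ∑ e, (if a e then 1 else 0) * oracle G₀ G₁ θ₀ α (z, a, x) e ∂(obsLaw G₀ G₁ θ₀ z a) ≤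
      ∑ e, (if a e then 1 else 0) *
        qfun G₀ G₁ true (thr G₀ G₁ θ₀ α) (z e.1.1) (z e.1.2) θ₀ θ₀ := by
  have := isProbabilityMeasure_obsLaw hθ₀ z a
  have hprob := fun e : Edge n => isProbabilityMeasure_noiseLaw hθ₀ (a e) (z e.1.1) (z e.1.2)
  set S : Edge n → Set ℝ := fun e =>
    {y | lfun G₀ G₁ y (z e.1.1) (z e.1.2) θ₀ ≤ thr G₀ G₁ θ₀ α} with hS
  have hSm : ∀ e, MeasurableSet (S e) := fun e => measurableSet_lfun_le hθ₀ _ _ _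
  set μ : Edge n → Measure ℝ := fun e => noiseLaw G₀ G₁ θ₀ (a e) (z e.1.1) (z e.1.2)
  have hi : ∀ e : Edge n, Integrable (fun x : Obs n => (S e).indicator (1 : ℝ → ℝ) (x e))
      (obsLaw G₀ G₁ θ₀ z a) := fun e => integrable_indicator_eval μ e (hSm e)
  have hm : ∀ e : Edge n, ∫ x, (S e).indicator (1 : ℝ → ℝ) (x e) ∂(obsLaw G₀ G₁ θ₀ z a) =
      (μ e).real (S e) := fun e => integral_indicator_eval μ e (hSm e)
  have h1 := integral_mono
    (integrable_detections (P := obsLaw G₀ G₁ θ₀ z a) a (measurable_oracle (α := α) hθ₀ z a)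
      (fun x e => oracle_nonneg _ e) (fun x e => oracle_le_one _ e))
    (integrable_finsetSum Finset.univ fun e _ => (hi e).const_mul (if a e then (1 : ℝ) else 0))
    (fun x => Finset.sum_le_sum fun e _ => mul_le_mul_of_nonneg_left (?_ :
      oracle G₀ G₁ θ₀ α (z, a, x) e ≤ (S e).indicator (1 : ℝ → ℝ) (x e))
      (by split_ifs <;> norm_num))
  · refine h1.trans (le_of_eq ?_)
    rw [integral_finsetSum _ fun e _ => (hi e).const_mul (if a e then (1 : ℝ) else 0)]
    refine Finset.sum_congr rfl fun e _ => ?_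
    rw [integral_const_mul, hm]
    cases hae : a e
    · simp
    · simp only [μ, hae]
      rfl
  · rw [oracle, indicator_apply]
    split_ifs with h2 h3
    · exact le_rfl
    · exact absurd (le_thr (lfun_mem_Icc hθ₀ _ _ _) h2) h3
    · norm_num
    · exact le_rfl

/-- The comparison of the plug-in and of the oracle procedures, before the rates are absorbed in
`x` and in the exponential terms. -/
theorem pi1_mul_tdr_oracle_le (hΘ : IsParamSpace G₀ G₁ Θ) (hθ₀ : θ₀ ∈ admissible G₀ G₁) {K : ℕ}
    (hn : 2 ≤ n) (hcomp : Complexity G₀ G₁ Θ K) {θhat : Obs n → Param Q d₀ d₁}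
    {Zhat : Obs n → Fin n → Fin Q}
    (hθhat : ∀ x, θhat x ∈ Θ) (hθm : Measurable θhat) (hZm : Measurable Zhat)
    (hφ : Measurable (plugIn G₀ G₁ θhat Zhat α)) (hε : ε < 1) (ht : t ∈ Icc (0 : ℝ) 1)
    (hΔ : 0 ≤ Δ)
    (hstep : ∀ θ ∈ Θ, ‖θ - θ₀‖ ≤ ε → (∀ s ≤ t, mfdr G₀ G₁ θ θ s ≤ α) ∧
      ∀ q l, qfun G₀ G₁ true (thr G₀ G₁ θ₀ α) q l θ₀ θ₀ - Δ ≤ qfun G₀ G₁ true t q l θ₀ θ) :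
    θ₀.pi1 * tdr G₀ G₁ θ₀ (oracle (n := n) G₀ G₁ θ₀ α) ≤
      θ₀.pi1 * tdr G₀ G₁ θ₀ (fun s : Sample n Q => plugIn G₀ G₁ θhat Zhat α s.2.2) + Δ +
        θ₀.pi1 * (law G₀ G₁ n θ₀).real {s | ε < pairDist (θhat s.2.2) (Zhat s.2.2) θ₀ s.1} +
        (4 * (K * Q) / √((n : ℝ) * (n - 1) / 2) + 1 / (2 * √n)) := by
  have hprob := fun z a => isProbabilityMeasure_obsLaw (n := n) hθ₀ z a
  have hm0 := card_edge_pos hn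
  have hSm : MeasurableSet
      {s : Sample n Q | ε < pairDist (θhat s.2.2) (Zhat s.2.2) θ₀ s.1} := by
    have : Measurable fun s : Sample n Q => pairDist (θhat s.2.2) (Zhat s.2.2) θ₀ s.1 := by
      refine measurable_from_prod_countable_right fun z => ?_
      exact (measurable_pairDist hθm hZm z).comp measurable_snd
    exact measurableSet_lt measurable_const this
  rw [pi1_mul_tdr hθ₀ hn _ fun z a => integrable_detections a (measurable_oracle hθ₀ z a)
      (fun x e => oracle_nonneg _ e) (fun x e => oracle_le_one _ e),
    pi1_mul_tdr hθ₀ hn _ fun z a => integrable_detections a hφ plugIn_nonneg plugIn_le_one,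
    law_real hθ₀ hSm]
  have hcard : (n : ℝ) * (n - 1) / 2 = Fintype.card (Edge n) := (card_edge n).symm
  rw [hcard]
  set m : ℝ := ((Fintype.card (Edge n) : ℕ) : ℝ) with hm
  set P : (Fin n → Fin Q) → (Edge n → Bool) → ℝ := fun z a =>
    (obsLaw G₀ G₁ θ₀ z a).real {x | (z, a, x) ∈
      {s : Sample n Q | ε < pairDist (θhat s.2.2) (Zhat s.2.2) θ₀ s.1}} with hP
  have key : ∀ z a,
      ∫ x, ∑ e, (if a e then 1 else 0) * oracle G₀ G₁ θ₀ α (z, a, x) e ∂(obsLaw G₀ G₁ θ₀ z a) ≤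
      ∫ x, ∑ e, (if a e then 1 else 0) * plugIn G₀ G₁ θhat Zhat α x e ∂(obsLaw G₀ G₁ θ₀ z a) +
        ((Δ * m + 4 * (K * Q) * √m) + (m * θ₀.pi1 * P z a +
          max 0 (∑ e, ((if a e then (1 : ℝ) else 0) - θ₀.pi1)))) := by
    intro z a
    have h1 := integral_oracle_le (α := α) hθ₀ z a
    have h2 := sum_le_integral_plugIn hΘ hθ₀ hcomp hθhat hθm hZm hφ hε ht hΔ
      (fun q l => qfun_le_one hθ₀ _ _ q l) hstep z a
    have h3 : (obsLaw G₀ G₁ θ₀ z a).real {x | ε < pairDist (θhat x) (Zhat x) θ₀ z} = P z a := rfl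
    rw [h3] at h2
    have hP0 : 0 ≤ P z a := measureReal_nonneg
    have hP1 : P z a ≤ 1 := measureReal_le_one
    simp only [mul_sub, Finset.sum_sub_distrib, ← Finset.sum_mul] at h2
    simp only [Finset.sum_sub_distrib, Finset.sum_const, Finset.card_univ, nsmul_eq_mul, ← hm]
    have h4 := sum_edges_le_card a
    rw [← hm] at h4
    set M : ℝ := ∑ e, if a e then 1 else 0
    have h5 : M * Δ ≤ m * Δ := mul_le_mul_of_nonneg_right h4 hΔ
    have h6 : (M - m * θ₀.pi1) * P z a ≤ max 0 (M - m * θ₀.pi1) :=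
      (mul_le_mul_of_nonneg_right (le_max_right 0 _) hP0).trans
        (mul_le_of_le_one_right (le_max_left _ _) hP1)
    linarith
  have hmean := latentMean_mono hθ₀ key
  rw [latentMean_add, latentMean_add fun _ _ => Δ * m + 4 * (K * Q) * √m, latentMean_const hθ₀,
    latentMean_add, latentMean_const_mul] at hmean
  have hexc := latentMean_excess_edges_le (n := n) hθ₀ hn
  have hrate : √n * ((n : ℝ) - 1) / 4 / m = 1 / (2 * √n) := by
    have hn' : (2 : ℝ) ≤ n := by exact_mod_cast hn
    have h1 : (n : ℝ) - 1 ≠ 0 := by linarith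
    have h2 : √(n : ℝ) ≠ 0 := (Real.sqrt_pos.2 (by linarith)).ne'
    have h3 : (n : ℝ) ≠ 0 := by linarith
    rw [← hcard]
    field_simp
    rw [Real.sq_sqrt (by linarith)]
    ring
  have hrate2 : 4 * ((K : ℝ) * Q) * √m / m = 4 * (K * Q) / √m := by
    have h2 : √m ≠ 0 := (Real.sqrt_pos.2 hm0).ne'
    rw [div_eq_div_iff hm0.ne' h2, mul_assoc, Real.mul_self_sqrt hm0.le]
  rw [← hrate, ← hrate2, div_le_iff₀ hm0]
  have e : ∀ x y p : ℝ, (x / m + Δ + θ₀.pi1 * p + (4 * (K * Q) * √m / m + y / m)) * m =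
      x + ((Δ * m + 4 * (K * Q) * √m) + (m * θ₀.pi1 * p + y)) := by
    intro x y p; field_simp; ring
  rw [e]
  linarith

end Discoveries

/-! ### Elementary bounds -/

section Trivial

theorem pi1_mul_tdr_nonneg (hθ₀ : θ₀ ∈ admissible G₀ G₁) {φ : Sample n Q → Edge n → ℝ}
    (h0 : ∀ s e, 0 ≤ φ s e) : 0 ≤ θ₀.pi1 * tdr G₀ G₁ θ₀ φ := by
  refine mul_nonneg (pi1_pos hθ₀).le (div_nonneg (integral_nonneg fun s => ?_)
    (integral_nonneg fun s => ?_))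
  · exact Finset.sum_nonneg fun e _ => mul_nonneg (by split_ifs <;> norm_num) (h0 s e)
  · exact Finset.sum_nonneg fun e _ => by split_ifs <;> norm_num

theorem pi1_mul_tdr_oracle_le_one (hθ₀ : θ₀ ∈ admissible G₀ G₁) (hn : 2 ≤ n) (α : ℝ) :
    θ₀.pi1 * tdr G₀ G₁ θ₀ (oracle (n := n) G₀ G₁ θ₀ α) ≤ 1 := by
  have hprob := fun z a => isProbabilityMeasure_obsLaw (n := n) hθ₀ z a
  rw [pi1_mul_tdr hθ₀ hn _ fun z a => integrable_detections a (measurable_oracle hθ₀ z a)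
      (fun x e => oracle_nonneg _ e) (fun x e => oracle_le_one _ e),
    div_le_one (card_edge_pos hn)]
  refine (latentMean_mono hθ₀ fun z a => ?_).trans (latentMean_const hθ₀ _).le
  refine (integral_oracle_le hθ₀ z a).trans (le_trans (Finset.sum_le_sum fun e _ => ?_)
    (sum_edges_le_card a))
  exact mul_le_of_le_one_right (by split_ifs <;> norm_num) (qfun_le_one hθ₀ _ _ _ _)

theorem piMin_sq_mul_wMin_le (hθ₀ : θ₀ ∈ admissible G₀ G₁) :
    0 < θ₀.piMin ∧ 0 < θ₀.wMin ∧ θ₀.piMin ≤ 1 ∧ θ₀.piMin ^ 2 * θ₀.wMin * (Q : ℝ) ^ 2 ≤ 1 := by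
  have : NeZero Q := ⟨by have := one_le_card_groups hθ₀; omega⟩
  obtain ⟨q, hq⟩ := exists_eq_ciInf_of_finite (f := fun q => θ₀.grp q)
  obtain ⟨p, hp⟩ := exists_eq_ciInf_of_finite (f := fun p : Fin Q × Fin Q => θ₀.con p.1 p.2)
  have hq' : θ₀.piMin = θ₀.grp q := hq.symm
  have hp' : θ₀.wMin = θ₀.con p.1 p.2 := hp.symm
  have h1 : θ₀.piMin * Q ≤ 1 := by
    rw [← hθ₀.2.1, mul_comm, ← nsmul_eq_mul]
    have := Finset.card_nsmul_le_sum Finset.univ θ₀.grp θ₀.piMin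
      fun q _ => ciInf_le (Set.finite_range _).bddBelow q
    simpa using this
  have hpos : 0 < θ₀.piMin := hq' ▸ hθ₀.1 q
  have hw := hθ₀.2.2.1 p.1 p.2
  rw [← hp'] at hw
  refine ⟨hpos, hw.1, hq' ▸ grp_le_one hθ₀ q, ?_⟩
  have h2 : (θ₀.piMin * Q) ^ 2 ≤ 1 := pow_le_one₀ (by positivity) h1
  calc _ = (θ₀.piMin * Q) ^ 2 * θ₀.wMin := by ring
    _ ≤ 1 * 1 := by gcongr; exact hw.1.le; exact hw.2.le
    _ = 1 := one_mul 1

end Trivial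
end NSBM

/-! ### Power of the plug-in procedure relative to the oracle -/

open NSBM in
theorem theorem2 {Q d₀ d₁ : ℕ} (G₀ : DensityFamily d₀) (G₁ : DensityFamily d₁)
    (Θ : Set (Param Q d₀ d₁)) (hΘ : IsParamSpace G₀ G₁ Θ)
    (t₁ t₂ : Fin Q → Fin Q → Param Q d₀ d₁ → ℝ) (hreg : Regularity G₀ G₁ Θ t₁ t₂)
    (θ₀ : Param Q d₀ d₁) (hθ₀ : θ₀ ∈ Θ)
    (α a b : ℝ) (ha : alphaStar G₀ G₁ t₁ θ₀ < a) (hb : b < θ₀.pi0) (hα : α ∈ Set.Ioo a b) :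
    ∃ e ∈ Set.Ioo (0 : ℝ) 1,
      ∀ K : ℕ, 0 < K → Complexity G₀ G₁ Θ K →
      ∀ n : ℕ, 2 ≤ n →
      ∀ (θhat : Obs n → Param Q d₀ d₁) (Zhat : Obs n → Fin n → Fin Q),
        (∀ x, θhat x ∈ Θ) → Measurable θhat → Measurable Zhat →
        Measurable (plugIn G₀ G₁ θhat Zhat α) →
      ∀ ε ∈ Set.Ioo 0 e, ∀ x : ℝ, 0 < x → x < min (θ₀.piMin ^ 2) θ₀.wMin →
        θ₀.pi1 * tdr G₀ G₁ θ₀ (fun s : Sample n Q => plugIn G₀ G₁ θhat Zhat α s.2.2) ≥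
          θ₀.pi1 * tdr G₀ G₁ θ₀ (oracle (n := n) G₀ G₁ θ₀ α) - x
          - θ₀.pi1 * (law G₀ G₁ n θ₀).real
              {s | ε < pairDist (θhat s.2.2) (Zhat s.2.2) θ₀ s.1}
          - 2 * modq G₀ G₁ Θ θ₀ (Set.Icc a b) ε - 6 * (Q : ℝ) ^ 2 * ε
          - modq1 G₀ G₁ θ₀ α (Set.Icc a b) (modT G₀ G₁ θ₀ α (Set.Icc a b)
              (8 * (kappa G₀ G₁ θ₀ a)⁻¹ *
                (modq G₀ G₁ Θ θ₀ (Set.Icc a b) ε + 3 * (Q : ℝ) ^ 2 * ε)))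
          - 2 * (Q : ℝ) ^ 2 *
              Real.exp (-(2 * ((n / 2 : ℕ) : ℝ) * x ^ 2 / (9 * (Q : ℝ) ^ 4)))
          - 6 * (K : ℝ) * (Q : ℝ) ^ 2 *
              Real.exp (-(((n : ℝ) * ((n : ℝ) - 1) / 2) * θ₀.piMin ^ 2 * θ₀.wMin * x ^ 2 /
                (9 * (K : ℝ) ^ 2))) := by
  have hadm := hΘ.subset_admissible hθ₀
  obtain ⟨e, he, hstep⟩ := exists_uniform_threshold hΘ hreg hθ₀ ha hα
  refine ⟨e, he, fun K hK hcomp n hn θhat Zhat hθhat hθm hZm hφ ε hε x hx hx' => ?_⟩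
  obtain ⟨t, ht, hstep⟩ := hstep ε hε
  obtain ⟨hp0, -, hp1, hpw⟩ := piMin_sq_mul_wMin_le hadm
  have hx1 : x < 1 :=
    (hx'.trans_le (min_le_left _ _)).trans_le (pow_le_one₀ hp0.le hp1)
  have hW := modq_nonneg (G₀ := G₀) (G₁ := G₁) (Θ := Θ) (θ₀ := θ₀) (𝒦 := Set.Icc a b) ε
  have hW1 := modq1_nonneg (G₀ := G₀) (G₁ := G₁) (θ₀ := θ₀) (𝒦 := Set.Icc a b) α
    (modT G₀ G₁ θ₀ α (Set.Icc a b) (8 * (kappa G₀ G₁ θ₀ a)⁻¹ *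
      (modq G₀ G₁ Θ θ₀ (Set.Icc a b) ε + 3 * (Q : ℝ) ^ 2 * ε)))
  have hQε : 0 ≤ 6 * (Q : ℝ) ^ 2 * ε := mul_nonneg (by positivity) hε.1.le
  have hPr : 0 ≤ θ₀.pi1 * (law G₀ G₁ n θ₀).real
      {s | ε < pairDist (θhat s.2.2) (Zhat s.2.2) θ₀ s.1} :=
    mul_nonneg (pi1_pos hadm).le measureReal_nonneg
  have hE1 : 0 ≤ 2 * (Q : ℝ) ^ 2 *
      Real.exp (-(2 * ((n / 2 : ℕ) : ℝ) * x ^ 2 / (9 * (Q : ℝ) ^ 4))) := by positivity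
  have hE2 : 0 ≤ 6 * (K : ℝ) * (Q : ℝ) ^ 2 *
      Real.exp (-(((n : ℝ) * ((n : ℝ) - 1) / 2) * θ₀.piMin ^ 2 * θ₀.wMin * x ^ 2 /
        (9 * (K : ℝ) ^ 2))) := by positivity
  rcases lt_or_ge (x + 2 * (Q : ℝ) ^ 2 *
        Real.exp (-(2 * ((n / 2 : ℕ) : ℝ) * x ^ 2 / (9 * (Q : ℝ) ^ 4))) +
      6 * (K : ℝ) * (Q : ℝ) ^ 2 *
        Real.exp (-(((n : ℝ) * ((n : ℝ) - 1) / 2) * θ₀.piMin ^ 2 * θ₀.wMin * x ^ 2 /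
          (9 * (K : ℝ) ^ 2)))) 1 with h | h
  · have hrate := rate_le hn hK (one_le_card_groups hadm) hx hx1 hpw h
    have hmain := pi1_mul_tdr_oracle_le hΘ hadm hn hcomp hθhat hθm hZm hφ (hε.2.trans he.2) ht
      (add_nonneg hW hW1) fun θ hθ hθε => ⟨(hstep θ hθ hθε).1, fun q l => by
        rw [← sub_sub]; exact (hstep θ hθ hθε).2 q l⟩
    linarith
  -- the exponential terms make the right-hand side nonpositive
  · have h1 := pi1_mul_tdr_oracle_le_one (n := n) hadm hn α
    have h2 := pi1_mul_tdr_nonneg (n := n) (φ := fun s => plugIn G₀ G₁ θhat Zhat α s.2.2) hadm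
      fun s e => plugIn_nonneg _ e
    linarith
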